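/- Let $L,r,R_1>0$ and $G,R_2\in\mathbb R$. There is a constant $C>0$, depending only on $L,G,r,R_1,R_2$, such that the following holds for all $d\ge 1$, $T\ge 2$ and $B_T,S_T\ge 0$. Let $\Omega\subseteq\mathbb R^d$ be closed and convex with $R_1\mathbb B\subseteq\Omega\subseteq R_2\mathbb B$, where $\mathbb B$ is the closed Euclidean unit ball. Let $f_1,\dots,f_T:\mathbb R^d\to\mathbb R$ be (deterministic) loss functions that are on $\Omega$ convex, $G$-Lipschitz and $L$-smooth (differentiable with $L$-Lipschitz gradient), let $f_0$ be any function differentiable on $\Omega$ (for example $f_0=0$), and let $\Omega_t^*$ be the set of minimizers of $f_t$ over $\Omega$. Assume $\|w-w^*\|_2\le r$ for all $w\in\Omega$, $w^*\in\Omega_t^*$, $1\le t\le T$, and $$V^p_T=\max_{w_t^*\in\Omega_t^*}\sum_{t=1}^{T-1}\|w_t^*-w_{t+1}^*\|_2\le B_T,\qquad V^g_T=\sum_{t=1}^{T}\sup_{w\in\Omega}\|\nabla f_t(w)-\nabla f_{t-1}(w)\|_2^2\le S_T .$$ Consider the two-point bandit META algorithm with $\xi=1/T$, $\delta=\xi R_1$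 and step size $\eta>0$: start with $w_1=\hat w_1=0$, $\hat g_0=0$; in round $t=1,\dots,T$ draw $i_t$ uniformly from $\{1,\dots,d\}$, independently of the past, submit $\hat w_t^1=\hat w_t+\delta e_{i_t}$ and $\hat w_t^2=\hat w_t-\delta e_{i_t}$, set $v_t=\frac1{2\delta}\bigl(f_t(\hat w^1_t)-f_t(\hat w^2_t)\bigr)$, $$g_t=d\,(v_t-\hat g_{t-1,i_t})e_{i_t}+\hat g_{t-1},\qquad \hat g_t=(v_t-\hat g_{t-1,i_t})e_{i_t}+\hat g_{t-1},$$ $$w_{t+1}=\Pi_{(1-\xi)\Omega}[w_t-\eta g_t],\qquad \hat w_{t+1}=\Pi_{(1-\xi)\Omega}[w_{t+1}-\eta\hat g_t],$$ where $\Pi_K$ is the Euclidean projection onto $K$. Let $w_t^*\in\Omega_t^*$ and $$\mathcal R_T=\mathrm E\Bigl[\sum_{t=1}^T\tfrac12\bigl(f_t(\hat w_t^1)+f_t(\hat w_t^2)\bigr)\Bigr]-\sum_{t=1}^Tf_t(w_t^*).$$ Then (with $\sqrt{a/0}=+\infty$ for $a>0$): 1. if $\eta=\min\Bigl(\sqrt{\frac{2rB_T+r^2}{8S_Td^4}},\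 \frac1{16Ld^{3/2}}\Bigr)$, then $$\mathcal R_T\le C\max\bigl\{d^2\sqrt{S_T\max(B_T,1)},\ d^{3/2}\max(B_T,1)\bigr\};$$ 2. if $\eta=\min\Bigl(\sqrt{\frac{2rB_T+r^2}{8S_Td^4}},\ \frac1{4Ld^{3/2}\sqrt{\ln T}}\Bigr)$, then $$\mathcal R_T\le C\max\bigl\{d^2\sqrt{S_T\max(B_T,1)},\ d^{3/2}\sqrt{\ln T}\,\max(B_T,1)\bigr\}.$$ -/

import Mathlib

open MeasureTheory ProbabilityTheory
open scoped NNReal ENNReal Pointwise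

namespace BanditOCO

/-- The decision space `ℝ^d` with the Euclidean norm. -/
abbrev E (d : ℕ) : Type := EuclideanSpace ℝ (Fin d)

/-- `y` is a Euclidean projection of `x` onto `K`. -/
def IsProj {d : ℕ} (K : Set (E d)) (x y : E d) : Prop :=
  y ∈ K ∧ ∀ z ∈ K, ‖x - y‖ ≤ ‖x - z‖

/-- The Euclidean projection `Π_K[x]`; for nonempty closed convex `K` it is the unique nearest
point of `K` (existence: `isProj_proj`). -/
noncomputable def proj {d : ℕ} (K : Set (E d)) (x : E d) : E d :=
  Classical.epsilon (IsProj K x)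

theorem isProj_proj {d : ℕ} {K : Set (E d)} (hK : IsClosed K) (hne : K.Nonempty) (x : E d) :
    IsProj K x (proj K x) := by
  apply Classical.epsilon_spec
  obtain ⟨y, hy, h⟩ := hK.exists_infDist_eq_dist hne x
  refine ⟨y, hy, fun z hz => ?_⟩
  rw [← dist_eq_norm, ← dist_eq_norm, ← h]
  exact Metric.infDist_le_dist_of_mem hz

/-- The set of minimizers of `f` over `Ω`. -/
def minimizers {d : ℕ} (Ω : Set (E d)) (f : E d → ℝ) : Set (E d) :=
  {w | w ∈ Ω ∧ IsMinOn f Ω w}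

/-- `f` is `L`-smooth on `Ω`: differentiable with `L`-Lipschitz gradient. On a convex set with
interior points the gradient within `Ω` is unique, and it is the ordinary gradient wherever `f`
is differentiable on the whole space. -/
def SmoothOn {d : ℕ} (L : ℝ) (Ω : Set (E d)) (f : E d → ℝ) : Prop :=
  DifferentiableOn ℝ f Ω ∧
    ∀ w ∈ Ω, ∀ w' ∈ Ω, ‖gradientWithin f Ω w - gradientWithin f Ω w'‖ ≤ L * ‖w - w'‖

/-- Path variation: the largest value of `∑_{t=1}^{T-1} ‖w*_t - w*_{t+1}‖` over all choices of
minimizers `w*_t` of `f_t` on `Ω`. -/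
noncomputable def pathVariation {d : ℕ} (Ω : Set (E d)) (f : ℕ → E d → ℝ) (T : ℕ) : ℝ≥0∞ :=
  ⨆ (w : ℕ → E d) (_ : ∀ t ∈ Finset.Icc 1 T, w t ∈ minimizers Ω (f t)),
    ∑ t ∈ Finset.Ico 1 T, ‖w t - w (t + 1)‖ₑ

/-- Gradient variation: `∑_{t=1}^T sup_{w ∈ Ω} ‖∇f_t(w) - ∇f_{t-1}(w)‖²`. -/
noncomputable def gradientVariation {d : ℕ} (Ω : Set (E d)) (f : ℕ → E d → ℝ) (T : ℕ) : ℝ≥0∞ :=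
  ∑ t ∈ Finset.Icc 1 T,
    ⨆ w ∈ Ω, ‖gradientWithin (f t) Ω w - gradientWithin (f (t - 1)) Ω w‖ₑ ^ 2

/-- What the algorithm carries into round `t`: the points `w_t`, `ŵ_t` and the gradient
estimate `ĝ_{t-1}`. -/
structure MetaState (d : ℕ) where
  w : E d
  wHat : E d
  gHat : E d

/-- The two points submitted in a round whose random coordinate is `i`. -/
noncomputable def queryPlus {d : ℕ} (δ : ℝ) (s : MetaState d) (i : Fin d) : E d :=
  s.wHat + δ • EuclideanSpace.single i (1 : ℝ)

noncomputable def queryMinus {d : ℕ} (δ : ℝ) (s : MetaState d) (i : Fin d) : E d :=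
  s.wHat - δ • EuclideanSpace.single i (1 : ℝ)

/-- One round of META on the loss `f` with random coordinate `i`; `K` is the shrunken domain
onto which the iterates are projected. -/
noncomputable def metaStep {d : ℕ} (K : Set (E d)) (δ η : ℝ) (f : E d → ℝ) (i : Fin d)
    (s : MetaState d) : MetaState d :=
  let v : ℝ := (f (queryPlus δ s i) - f (queryMinus δ s i)) / (2 * δ)
  let g : E d := ((d : ℝ) * (v - s.gHat i)) • EuclideanSpace.single i (1 : ℝ) + s.gHat
  let gHat' : E d := (v - s.gHat i) • EuclideanSpace.single i (1 : ℝ) + s.gHat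
  let w' : E d := proj K (s.w - η • g)
  { w := w'
    wHat := proj K (w' - η • gHat')
    gHat := gHat' }

/-- The state after `n` rounds, on the losses `f 1, f 2, …` with random coordinates
`i 1, i 2, …`; that is, `(w_{n+1}, ŵ_{n+1}, ĝ_n)`. -/
noncomputable def metaRun {d : ℕ} (K : Set (E d)) (δ η : ℝ) (f : ℕ → E d → ℝ) (i : ℕ → Fin d) :
    ℕ → MetaState d
  | 0 => { w := 0, wHat := 0, gHat := 0 }
  | n + 1 => metaStep K δ η (f (n + 1)) (i (n + 1)) (metaRun K δ η f i n)

/-- Total loss of META over `T` rounds, averaged over the two submitted points of each round,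
with `ξ = 1/T` and `δ = ξ R₁`. -/
noncomputable def metaLoss {d : ℕ} (Ω : Set (E d)) (R₁ η : ℝ) (T : ℕ) (f : ℕ → E d → ℝ)
    (i : ℕ → Fin d) : ℝ :=
  let ξ : ℝ := 1 / (T : ℝ)
  let δ : ℝ := ξ * R₁
  ∑ t ∈ Finset.Icc 1 T,
    (f t (queryPlus δ (metaRun ((1 - ξ) • Ω) δ η f i (t - 1)) (i t)) +
      f t (queryMinus δ (metaRun ((1 - ξ) • Ω) δ η f i (t - 1)) (i t))) / 2

/-- `min (√((2 r B + r²) / (8 S d⁴)), cap)`, where the first term is `+∞` if `S = 0`. -/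
noncomputable def stepSize (d : ℕ) (r B S cap : ℝ) : ℝ :=
  if S = 0 then cap
  else min (Real.sqrt ((2 * r * B + r ^ 2) / (8 * S * (d : ℝ) ^ 4))) cap

/-- The random coordinates: independent and uniform on the `d` coordinates. -/
def IsUniformIID {d : ℕ} {P : Type*} [MeasurableSpace P] (μ : Measure P) (i : ℕ → P → Fin d) :
    Prop :=
  (∀ t, Measurable (i t)) ∧ iIndepFun i μ ∧ ∀ t k, μ (i t ⁻¹' {k}) = (d : ℝ≥0∞)⁻¹

end BanditOCO

/-! The vector V of central difference quotients at ŵ (`diffQuot`) replaces the gradient up to an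
error √d·Lδ/2. Both estimates of a round are ĝ plus a one-coordinate correction taken from x = V -
ĝ. Averaged over the coordinate, g equals V, so the expected linearized regret is that of optimistic
mirror descent with prediction ĝ, and its price η‖g - ĝ‖² averages to ηd‖x‖².

The sum of the ‖x‖² is controlled without asking when each coordinate was last sampled: the error is
put into the potential ‖w - u‖²/(2η) + 2ηd²‖V - ĝ‖² - ‖ŵ - w‖²/(4η). Refreshing one uniform
coordinate multiplies ‖x‖² by 1 - 1/d on average (`sum_norm_sq_sub_single`), and this gain pays for
ηd‖x‖². The change of V between rounds costs a multiple of ηd³ times gradient variation,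
discretization error and movement of the iterates; the movement is absorbed by the negative terms of
`optimistic_step` as soon as 96η²d³L² ≤ 1. This is `sum_loss_add_potential_le`. Summing it in
expectation (`integral_sum_le_of_potential`) gives `Setting.regret_le`, in which no logarithm of T
occurs.

Hence both step sizes fall under one estimate, `Setting.tuned_regret_le`, with cap 1/(κLd^{3/2}) and
κ ≥ 16. The leftover cases T < d and 4√(ln T) < 16 follow from the trivial bound
`Setting.regret_le_linear`. -/

namespace BanditOCO

/-! ### Geometry of one round -/

/-- The variational inequality of the Euclidean projection onto a convex set. -/
theorem IsProj.inner_le_zero {d : ℕ} {K : Set (E d)} (hK : Convex ℝ K) {x y z : E d}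
    (h : IsProj K x y) (hz : z ∈ K) : inner ℝ (x - y) (z - y) ≤ 0 := by
  refine (norm_eq_iInf_iff_real_inner_le_zero hK h.1).1 ?_ z hz
  have : Nonempty K := ⟨⟨y, h.1⟩⟩
  apply le_antisymm
  · exact le_ciInf fun w => h.2 w w.2
  · exact ciInf_le (f := fun w : K => ‖x - w‖) ⟨0, by rintro _ ⟨w, rfl⟩; positivity⟩ ⟨y, h.1⟩

/-- One round of optimistic mirror descent with prediction `gHat` and gradient `g`. -/
theorem optimistic_step {F : Type*} [NormedAddCommGroup F] [InnerProductSpace ℝ F]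
    {η : ℝ} {w wHat w' u g gHat : F}
    (h₁ : inner ℝ (w - η • g - w') (u - w') ≤ 0)
    (h₂ : inner ℝ (w - η • gHat - wHat) (w' - wHat) ≤ 0) :
    η * inner ℝ g (wHat - u) ≤ ‖w - u‖ ^ 2 / 2 - ‖w' - u‖ ^ 2 / 2 + η ^ 2 * ‖g - gHat‖ ^ 2
      - ‖w' - wHat‖ ^ 2 / 4 - ‖wHat - w‖ ^ 2 / 2 := by
  obtain ⟨p, rfl⟩ : ∃ p, wHat = w + p := ⟨wHat - w, by abel⟩
  obtain ⟨q, rfl⟩ : ∃ q, w' = w + p + q := ⟨w' - (w + p), by abel⟩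
  obtain ⟨z, rfl⟩ : ∃ z, u = w + p + q + z := ⟨u - (w + p + q), by abel⟩
  -- Young's inequality for -η⟨g - ĝ, q⟩; it spends ‖q‖²/4 of the available ‖q‖²/2 and leaves ‖q‖²/4
  -- as a negative term.
  have h₃ : 0 ≤ ‖η • (g - gHat) + (1 / 2 : ℝ) • q‖ ^ 2 := by positivity
  have e1 : w - η • g - (w + p + q) = -(η • g + p + q) := by abel
  have e2 : w + p + q + z - (w + p + q) = z := by abel
  have e3 : w - η • gHat - (w + p) = -(η • gHat + p) := by abel
  have e4 : w + p + q - (w + p) = q := by abel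
  have e5 : w + p - (w + p + q + z) = -(q + z) := by abel
  have e6 : w - (w + p + q + z) = -(p + q + z) := by abel
  have e7 : w + p + q - (w + p + q + z) = -z := by abel
  have e8 : w + p - w = p := by abel
  rw [e1, e2] at h₁
  rw [e3, e4] at h₂
  rw [e4, e5, e6, e7, e8]
  simp only [← real_inner_self_eq_norm_sq, inner_add_left, inner_add_right, inner_neg_left,
    inner_neg_right, inner_sub_left, inner_sub_right, real_inner_smul_left,
    real_inner_smul_right] at *
  rw [real_inner_comm q p, real_inner_comm z p, real_inner_comm z q, real_inner_comm gHat g,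
    real_inner_comm q g, real_inner_comm q gHat] at *
  linarith

/-- Moving the comparator from `u` to `u'` costs at most `r ‖u - u'‖`. -/
theorem sq_dist_comparator_le {F : Type*} [NormedAddCommGroup F] [InnerProductSpace ℝ F]
    {r : ℝ} {w u u' : F} (h : ‖w - u‖ ≤ r) (h' : ‖w - u'‖ ≤ r) :
    ‖w - u'‖ ^ 2 / 2 - ‖w - u‖ ^ 2 / 2 ≤ r * ‖u - u'‖ := by
  have h₁ : ‖w - u'‖ - ‖w - u‖ ≤ ‖u - u'‖ := by
    have := norm_sub_norm_le (w - u') (w - u)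
    rwa [sub_sub_sub_cancel_left] at this
  nlinarith [norm_nonneg (w - u), norm_nonneg (w - u'), norm_nonneg (u - u'),
    mul_le_mul_of_nonneg_left h₁ (add_nonneg (norm_nonneg (w - u')) (norm_nonneg (w - u))),
    mul_le_mul_of_nonneg_right (add_le_add h' h) (norm_nonneg (u - u'))]

/-! ### First-order facts on the domain -/

/-- Restriction to the segment from x to y reduces this to a slope inequality in one variable. The
derivative is only taken within Ω, so boundary points are allowed. -/
theorem add_inner_gradientWithin_le {F : Type*} [NormedAddCommGroup F] [InnerProductSpace ℝ F]
    [CompleteSpace F] {Ω : Set F} {f : F → ℝ} (hc : ConvexOn ℝ Ω f)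
    (hd : DifferentiableOn ℝ f Ω) {x y : F} (hx : x ∈ Ω) (hy : y ∈ Ω) :
    f x + inner ℝ (gradientWithin f Ω x) (y - x) ≤ f y := by
  have hmaps : Set.MapsTo (AffineMap.lineMap x y : ℝ → F) (Set.Icc 0 1) Ω :=
    fun t ht => hc.1.lineMap_mem hx hy ht
  have h1 : ConvexOn ℝ (Set.Icc (0 : ℝ) 1) (f ∘ (AffineMap.lineMap x y : ℝ →ᵃ[ℝ] F)) :=
    (hc.comp_affineMap _).subset hmaps (convex_Icc _ _)
  have h2 := hasGradientWithinAt_iff_hasFDerivWithinAt.1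
    (hd x hx).hasGradientWithinAt
  have h3 : HasDerivWithinAt (AffineMap.lineMap x y : ℝ → F) (y - x) (Set.Icc (0 : ℝ) 1) 0 :=
    AffineMap.hasDerivWithinAt_lineMap
  have h4 := HasFDerivWithinAt.comp_hasDerivWithinAt (l := f) (t := Ω)
    (l' := InnerProductSpace.toDual ℝ F (gradientWithin f Ω x)) (0 : ℝ)
    (by simpa using h2) h3 hmaps
  have h5 := h1.le_slope_of_hasDerivWithinAt (by simp) (by simp) zero_lt_one h4
  rw [InnerProductSpace.toDual_apply_apply, slope_def_field] at h5
  simp only [Function.comp_apply, AffineMap.lineMap_apply_one, AffineMap.lineMap_apply_zero,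
    sub_zero, div_one] at h5
  linarith

/-- The vector of two-point difference quotients of `f` at `x` along the coordinates. -/
noncomputable def diffQuot {d : ℕ} (δ : ℝ) (f : E d → ℝ) (x : E d) : E d :=
  WithLp.toLp 2 fun k => (f (x + δ • EuclideanSpace.single k (1 : ℝ)) -
    f (x - δ • EuclideanSpace.single k (1 : ℝ))) / (2 * δ)

theorem norm_le_sqrt_card_mul {d : ℕ} {c : ℝ} (hc : 0 ≤ c) {x : E d} (h : ∀ k, |x k| ≤ c) :
    ‖x‖ ≤ √d * c := by
  rw [EuclideanSpace.norm_eq]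
  calc √(∑ k, ‖x k‖ ^ 2) ≤ √(∑ _k : Fin d, c ^ 2) := by
        apply Real.sqrt_le_sqrt
        exact Finset.sum_le_sum fun k _ => pow_le_pow_left₀ (norm_nonneg _) (h k) 2
    _ = √d * c := by
        rw [Finset.sum_const, Finset.card_univ, Fintype.card_fin, nsmul_eq_mul,
          Real.sqrt_mul (Nat.cast_nonneg d), Real.sqrt_sq hc]

/-- By convexity at both ends, f(x ± δe) - f(x) exceeds its linear part by an amount in [0, Lδ²].
The two one-sided errors are subtracted, so the quotient is off by at most Lδ²/(2δ) per coordinate.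
-/
theorem norm_diffQuot_sub_gradientWithin_le {d : ℕ} {Ω : Set (E d)} {f : E d → ℝ} {L δ : ℝ}
    (hL : 0 ≤ L) (hδ : 0 < δ) (hc : ConvexOn ℝ Ω f) (hs : SmoothOn L Ω f) {x : E d} (hx : x ∈ Ω)
    (hp : ∀ k, x + δ • EuclideanSpace.single k (1 : ℝ) ∈ Ω)
    (hm : ∀ k, x - δ • EuclideanSpace.single k (1 : ℝ) ∈ Ω) :
    ‖diffQuot δ f x - gradientWithin f Ω x‖ ≤ √d * (L * δ / 2) := by
  refine norm_le_sqrt_card_mul (by positivity) fun k => ?_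
  set e : E d := EuclideanSpace.single k (1 : ℝ) with he
  set g := gradientWithin f Ω
  have hne : ‖δ • e‖ = δ := by rw [norm_smul]; simp [he, abs_of_pos hδ]
  have hin : ∀ a : E d, inner ℝ a (δ • e) = δ * a k := by
    intro a; rw [real_inner_smul_right, he, EuclideanSpace.inner_single_right]; simp
  have key : ∀ y ∈ Ω, ‖y - x‖ = δ → |inner ℝ (g y - g x) (δ • e)| ≤ L * δ * δ := by
    intro y hy hyx
    calc _ ≤ ‖g y - g x‖ * ‖δ • e‖ := abs_real_inner_le_norm _ _
      _ ≤ (L * δ) * δ := by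
        rw [hne]; gcongr
        calc _ ≤ L * ‖y - x‖ := hs.2 _ hy _ hx
          _ = _ := by rw [hyx]
  have a1 := add_inner_gradientWithin_le hc hs.1 hx (hp k)
  have a2 := add_inner_gradientWithin_le hc hs.1 (hp k) hx
  have a3 := add_inner_gradientWithin_le hc hs.1 hx (hm k)
  have a4 := add_inner_gradientWithin_le hc hs.1 (hm k) hx
  have k1 := abs_le.1 (key _ (hp k) (by rw [add_sub_cancel_left, hne]))
  have k2 := abs_le.1 (key _ (hm k) (by rw [sub_sub_cancel_left, norm_neg, hne]))
  rw [add_sub_cancel_left, hin] at a1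
  rw [sub_add_cancel_left, inner_neg_right] at a2
  rw [sub_sub_cancel_left, inner_neg_right, hin] at a3
  rw [sub_sub_cancel] at a4
  rw [inner_sub_left, hin (g x)] at k1 k2
  change |(f (x + δ • e) - f (x - δ • e)) / (2 * δ) - g x k| ≤ L * δ / 2
  have : (f (x + δ • e) - f (x - δ • e)) / (2 * δ) - g x k
      = (f (x + δ • e) - f (x - δ • e) - 2 * (δ * g x k)) / (2 * δ) := by
    field_simp
  rw [this, abs_div, abs_of_pos (by positivity : 0 < 2 * δ), div_le_iff₀ (by positivity), abs_le]
  constructor <;> linarith [k1.1, k1.2, k2.1, k2.2]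

/-- Serves the first round only: there ĝ = 0, and the estimation error is the whole quotient vector.
-/
theorem norm_diffQuot_le {d : ℕ} {Ω : Set (E d)} {f : E d → ℝ} {G δ : ℝ} (hG : 0 ≤ G)
    (hδ : 0 < δ) (hf : ∀ w ∈ Ω, ∀ w' ∈ Ω, |f w - f w'| ≤ G * ‖w - w'‖) {x : E d}
    (hp : ∀ k, x + δ • EuclideanSpace.single k (1 : ℝ) ∈ Ω)
    (hm : ∀ k, x - δ • EuclideanSpace.single k (1 : ℝ) ∈ Ω) :
    ‖diffQuot δ f x‖ ≤ √d * G := by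
  refine norm_le_sqrt_card_mul hG fun k => ?_
  have h := hf _ (hp k) _ (hm k)
  rw [add_sub_sub_cancel, ← two_smul ℝ, smul_smul, norm_smul] at h
  simp only [PiLp.norm_single, norm_one, mul_one, Real.norm_eq_abs] at h
  rw [abs_of_pos (by positivity : 0 < 2 * δ)] at h
  change |(f _ - f _) / (2 * δ)| ≤ G
  rwa [abs_div, abs_of_pos (by positivity : 0 < 2 * δ), div_le_iff₀ (by positivity)]

/-! ### Averages over the sampled coordinate -/

/-- Divided by d, this is the unbiasedness of the estimate with the factor d. -/
theorem sum_inner_single {d : ℕ} (x z : E d) :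
    ∑ k, inner ℝ (x k • EuclideanSpace.single k (1 : ℝ)) z = inner ℝ x z := by
  simp only [PiLp.inner_apply]
  simp [mul_comm]

theorem sum_norm_sq_single {d : ℕ} (x : E d) :
    ∑ k, ‖x k • (EuclideanSpace.single k (1 : ℝ) : E d)‖ ^ 2 = ‖x‖ ^ 2 := by
  rw [EuclideanSpace.norm_sq_eq]
  simp [norm_smul]

/-- The contraction behind the method: erasing one uniform coordinate of the error keeps the
fraction 1 - 1/d of its square on average. -/
theorem sum_norm_sq_sub_single {d : ℕ} (x : E d) :
    ∑ k, ‖x - x k • EuclideanSpace.single k (1 : ℝ)‖ ^ 2 = ((d : ℝ) - 1) * ‖x‖ ^ 2 := by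
  simp only [norm_sub_sq_real, Finset.sum_add_distrib, Finset.sum_sub_distrib,
    sum_norm_sq_single, ← Finset.mul_sum]
  simp_rw [real_inner_comm _ x]
  rw [sum_inner_single, real_inner_self_eq_norm_sq]
  simp
  ring

/-! ### Expectations along uniform coordinates -/

/-- A quantity that reads finitely many coordinates factors through a finite type. Measurability and
integrability are then automatic, and no measurability of projections or losses is needed. -/
theorem exists_comp_of_dependsOn {d : ℕ} {P : Type*} (i : ℕ → P → Fin d) {s : Finset ℕ}
    {Φ : (ℕ → Fin d) → ℝ} (hΦ : DependsOn Φ (s : Set ℕ)) :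
    ∃ φ : (s → Fin d) → ℝ, ∀ ω : P, Φ (fun t => i t ω) = φ (fun t => i t ω) := by
  obtain ⟨φ, rfl⟩ := dependsOn_iff_exists_comp.1 hΦ
  exact ⟨φ, fun ω => rfl⟩

/-- Adaptedness in deterministic form; it makes coordinate n + 1 fresh for the state after n rounds.
-/
theorem dependsOn_recursion {d : ℕ} {σ : Type*} {X : (ℕ → Fin d) → ℕ → σ}
    {step : ℕ → Fin d → σ → σ} {x₀ : σ} (hX₀ : ∀ j, X j 0 = x₀)
    (hX : ∀ j n, X j (n + 1) = step n (j (n + 1)) (X j n)) (n : ℕ) :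
    DependsOn (fun j => X j n) (Finset.Icc 1 n : Finset ℕ) := by
  induction n with
  | zero => intro x y _; simp [hX₀]
  | succ n ih =>
    intro x y h
    have h1 : X x n = X y n := ih fun t ht => h t (by simp at ht ⊢; omega)
    simp only [hX, h1, h (n + 1) (by simp)]

theorem dependsOn_sum_recursion {d : ℕ} {σ : Type*} {X : (ℕ → Fin d) → ℕ → σ}
    {step : ℕ → Fin d → σ → σ} {x₀ : σ} (hX₀ : ∀ j, X j 0 = x₀)
    (hX : ∀ j n, X j (n + 1) = step n (j (n + 1)) (X j n)) {ℓ : ℕ → Fin d → σ → ℝ} (N : ℕ) :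
    DependsOn (fun j => ∑ n ∈ Finset.range N, ℓ n (j (n + 1)) (X j n))
      (Finset.Icc 1 N : Finset ℕ) := by
  intro x y h
  refine Finset.sum_congr rfl fun n hn => ?_
  rw [Finset.mem_range] at hn
  have h1 : X x n = X y n :=
    dependsOn_recursion hX₀ hX n fun t ht => h t (by simp at ht ⊢; omega)
  rw [h1, h (n + 1) (by simp; omega)]

section Expectation

variable {d : ℕ} {P : Type*} [MeasurableSpace P] {μ : Measure P} [IsProbabilityMeasure μ]
  {i : ℕ → P → Fin d}

theorem integrable_of_dependsOn (hi : ∀ t, Measurable (i t)) {s : Finset ℕ}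
    {Φ : (ℕ → Fin d) → ℝ} (hΦ : DependsOn Φ (s : Set ℕ)) :
    Integrable (fun ω => Φ (fun t => i t ω)) μ := by
  obtain ⟨φ, hφ⟩ := exists_comp_of_dependsOn i hΦ
  simp_rw [hφ]
  have hm : Measurable (fun ω (t : s) => i t ω) := measurable_pi_lambda _ fun t => hi t
  have := Measure.isProbabilityMeasure_map (μ := μ) hm.aemeasurable
  exact (Integrable.of_finite (f := φ) (μ := μ.map fun ω (t : s) => i t ω)).comp_measurable hm

/-- A fresh uniform coordinate may be averaged out. -/
theorem integral_fresh_coordinate (hi : IsUniformIID μ i) {s : Finset ℕ} {n : ℕ} (hn : n ∉ s)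
    {Φ : Fin d → (ℕ → Fin d) → ℝ} (hΦ : ∀ k, DependsOn (Φ k) (s : Set ℕ)) :
    ∫ ω, Φ (i n ω) (fun t => i t ω) ∂μ = ∫ ω, (∑ k, Φ k (fun t => i t ω)) / d ∂μ := by
  -- Splitting by the value of the fresh coordinate turns each term into a product of independent
  -- factors.
  have hsplit : ∀ ω, Φ (i n ω) (fun t => i t ω)
      = ∑ k, Φ k (fun t => i t ω) * (i n ⁻¹' {k}).indicator 1 ω := by
    intro ω
    classical
    simp [Set.indicator_apply]
  have hind : ∀ k, IndepFun (fun ω => Φ k (fun t => i t ω))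
      ((i n ⁻¹' {k}).indicator (1 : P → ℝ)) μ := by
    intro k
    obtain ⟨φ, hφ⟩ := exists_comp_of_dependsOn i (hΦ k)
    have h := hi.2.1.indepFun_finset s {n} (by simpa using hn) hi.1
    have h' := h.comp (φ := φ)
      (ψ := fun x => if x ⟨n, by simp⟩ = k then (1 : ℝ) else 0)
      (measurable_of_finite _) (measurable_of_finite _)
    convert h' using 1
    · funext ω; exact hφ ω
    · funext ω
      classical
      simp [Set.indicator_apply]
  have hmeas : ∀ k, MeasurableSet (i n ⁻¹' {k}) := fun k => hi.1 n (measurableSet_singleton k)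
  have hmul : ∀ k, ∫ ω, Φ k (fun t => i t ω) * (i n ⁻¹' {k}).indicator 1 ω ∂μ
      = (∫ ω, Φ k (fun t => i t ω) ∂μ) * (d : ℝ)⁻¹ := by
    intro k
    rw [(hind k).integral_fun_mul_eq_mul_integral
      (integrable_of_dependsOn hi.1 (hΦ k)).aestronglyMeasurable
      (measurable_one.indicator (hmeas k)).aestronglyMeasurable, integral_indicator_one (hmeas k)]
    simp [Measure.real, hi.2.2]
  simp_rw [hsplit]
  rw [integral_finsetSum, integral_div, integral_finsetSum, div_eq_mul_inv, Finset.sum_mul]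
  · exact Finset.sum_congr rfl fun k _ => hmul k
  · exact fun k _ => integrable_of_dependsOn hi.1 (hΦ k)
  · intro k _
    refine (integrable_of_dependsOn hi.1 (hΦ k)).mul_bdd (c := 1)
      (measurable_one.indicator (hmeas k)).aestronglyMeasurable (ae_of_all _ fun ω => ?_)
    by_cases h : ω ∈ i n ⁻¹' {k} <;> simp [h]

/-- If along a randomly driven recursion `X` a potential `Ψ` decreases on average by at least the
cost `ℓ` up to errors `c`, then the expected total cost is controlled by the potential. -/
theorem integral_sum_add_potential_le (hi : IsUniformIID μ i) {σ : Type*}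
    {X : (ℕ → Fin d) → ℕ → σ} {step : ℕ → Fin d → σ → σ} {x₀ : σ} (hX₀ : ∀ j, X j 0 = x₀)
    (hX : ∀ j n, X j (n + 1) = step n (j (n + 1)) (X j n))
    {ℓ : ℕ → Fin d → σ → ℝ} {Ψ : ℕ → σ → ℝ} {c : ℕ → ℝ} {T : ℕ}
    (hstep : ∀ n < T, ∀ j,
      (∑ k, (ℓ n k (X j n) + Ψ (n + 1) (step n k (X j n)))) / d ≤ Ψ n (X j n) + c n) :
    ∫ ω, (∑ n ∈ Finset.range T, ℓ n (i (n + 1) ω) (X (fun t => i t ω) n)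
        + Ψ T (X (fun t => i t ω) T)) ∂μ
      ≤ Ψ 0 x₀ + ∑ n ∈ Finset.range T, c n := by
  have hdep := dependsOn_recursion hX₀ hX
  have hdepℓ := dependsOn_sum_recursion hX₀ hX (ℓ := ℓ)
  have hdepΨ : ∀ n, DependsOn (fun j => Ψ n (X j n)) (Finset.Icc 1 n : Finset ℕ) :=
    fun n x y h => congrArg (Ψ n) (hdep n h)
  induction T with
  | zero => simp [hX₀]
  | succ N ih =>
    have ih := ih fun n hn => hstep n (by omega)
    have h1 := integrable_of_dependsOn (μ := μ) hi.1 (hdepℓ N)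
    have h2 := integrable_of_dependsOn (μ := μ) hi.1 (hdepΨ N)
    have hdepF : ∀ k, DependsOn (fun j => ℓ N k (X j N) + Ψ (N + 1) (step N k (X j N)))
        (Finset.Icc 1 N : Finset ℕ) := fun k x y h => by
      have h1 : X x N = X y N := hdep N h
      simp only [h1]
    have h3 := integral_fresh_coordinate (μ := μ) hi (n := N + 1) (by simp) hdepF
    have hdepS : DependsOn
        (fun j => (∑ k, (ℓ N k (X j N) + Ψ (N + 1) (step N k (X j N)))) / d)
        (Finset.Icc 1 N : Finset ℕ) := fun x y h => by
      have h1 : X x N = X y N := hdep N h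
      simp only [h1]
    have hdepF' : DependsOn
        (fun j : ℕ → Fin d => ℓ N (j (N + 1)) (X j N) + Ψ (N + 1) (step N (j (N + 1)) (X j N)))
        (Finset.Icc 1 (N + 1) : Finset ℕ) := fun x y h => by
      have h1 : X x N = X y N := hdep N fun t ht => h t (by simp at ht ⊢; omega)
      simp only [h1, h (N + 1) (by simp)]
    have h4 := integrable_of_dependsOn (μ := μ) hi.1 hdepF'
    have h5 : ∫ ω, (∑ k, (ℓ N k (X (fun t => i t ω) N)
          + Ψ (N + 1) (step N k (X (fun t => i t ω) N)))) / d ∂μ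
        ≤ ∫ ω, (Ψ N (X (fun t => i t ω) N) + c N) ∂μ :=
      integral_mono (integrable_of_dependsOn hi.1 hdepS) (h2.add (integrable_const _))
        fun ω => hstep N (by omega) _
    rw [integral_add h2 (integrable_const _), integral_const, probReal_univ, one_smul] at h5
    rw [integral_add h1 h2] at ih
    simp_rw [Finset.sum_range_succ, hX, add_assoc]
    rw [integral_add h1 h4, h3]
    linarith

/-- The expected total cost, once the final potential is bounded below. -/
theorem integral_sum_le_of_potential (hi : IsUniformIID μ i) {σ : Type*}
    {X : (ℕ → Fin d) → ℕ → σ} {step : ℕ → Fin d → σ → σ} {x₀ : σ} (hX₀ : ∀ j, X j 0 = x₀)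
    (hX : ∀ j n, X j (n + 1) = step n (j (n + 1)) (X j n))
    {ℓ : ℕ → Fin d → σ → ℝ} {Ψ : ℕ → σ → ℝ} {c : ℕ → ℝ} {T : ℕ}
    (hstep : ∀ n < T, ∀ j,
      (∑ k, (ℓ n k (X j n) + Ψ (n + 1) (step n k (X j n)))) / d ≤ Ψ n (X j n) + c n)
    {m : ℝ} (hm : ∀ j, -m ≤ Ψ T (X j T)) :
    ∫ ω, ∑ n ∈ Finset.range T, ℓ n (i (n + 1) ω) (X (fun t => i t ω) n) ∂μ
      ≤ Ψ 0 x₀ + ∑ n ∈ Finset.range T, c n + m := by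
  have h := integral_sum_add_potential_le (μ := μ) hi hX₀ hX hstep
  have h1 := integrable_of_dependsOn (μ := μ) hi.1 (dependsOn_sum_recursion hX₀ hX (ℓ := ℓ) T)
  have h2 : Integrable (fun ω => Ψ T (X (fun t => i t ω) T)) μ :=
    integrable_of_dependsOn hi.1 (Φ := fun j => Ψ T (X j T))
      fun x y h => congrArg (Ψ T) (dependsOn_recursion hX₀ hX T h)
  rw [integral_add h1 h2] at h
  have h3 := integral_mono (integrable_const (μ := μ) (-m)) h2 fun ω => hm _
  rw [integral_const, probReal_univ, one_smul] at h3
  linarith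

end Expectation

/-! ### The averaged one-round inequality -/

/-- The assumptions on a single loss. -/
structure RegularLoss {d : ℕ} (L G : ℝ) (Ω : Set (E d)) (f : E d → ℝ) : Prop where
  convexOn : ConvexOn ℝ Ω f
  lipschitz : ∀ w ∈ Ω, ∀ w' ∈ Ω, |f w - f w'| ≤ G * ‖w - w'‖
  smooth : SmoothOn L Ω f

/-- `K` is a closed convex subset of `Ω` at coordinate distance at least `δ` from its complement. -/
structure IsCore {d : ℕ} (δ : ℝ) (K Ω : Set (E d)) : Prop where
  isClosed : IsClosed K
  convex : Convex ℝ K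
  subset : K ⊆ Ω
  add_mem : ∀ x ∈ K, ∀ k, x + δ • EuclideanSpace.single k (1 : ℝ) ∈ Ω
  sub_mem : ∀ x ∈ K, ∀ k, x - δ • EuclideanSpace.single k (1 : ℝ) ∈ Ω

/-- Reachable states: both points lie in `K` and the second is the optimistic step. -/
structure IsReachable {d : ℕ} (K : Set (E d)) (η : ℝ) (s : MetaState d) : Prop where
  w_mem : s.w ∈ K
  wHat_mem : s.wHat ∈ K
  isProj : IsProj K (s.w - η • s.gHat) s.wHat

theorem isReachable_metaStep {d : ℕ} {K : Set (E d)} (hK : IsClosed K) (hne : K.Nonempty)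
    (δ η : ℝ) (f : E d → ℝ) (k : Fin d) (s : MetaState d) :
    IsReachable K η (metaStep K δ η f k s) :=
  ⟨(isProj_proj hK hne _).1, (isProj_proj hK hne _).1, isProj_proj hK hne _⟩

theorem isReachable_metaRun {d : ℕ} {K : Set (E d)} (hK : IsClosed K) (h0 : 0 ∈ K)
    (δ η : ℝ) (f : ℕ → E d → ℝ) (i : ℕ → Fin d) (n : ℕ) :
    IsReachable K η (metaRun K δ η f i n) := by
  cases n with
  | zero => exact ⟨h0, h0, h0, fun z _ => by simp [metaRun]⟩
  | succ n => exact isReachable_metaStep hK ⟨0, h0⟩ _ _ _ _ _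

/-- The potential before a round with loss `f` and comparator `u`. -/
noncomputable def potential {d : ℕ} (δ η : ℝ) (f : E d → ℝ) (u : E d) (s : MetaState d) : ℝ :=
  ‖s.w - u‖ ^ 2 / (2 * η) + 2 * η * (d : ℝ) ^ 2 * ‖diffQuot δ f s.wHat - s.gHat‖ ^ 2
    - ‖s.wHat - s.w‖ ^ 2 / (4 * η)

/-- The observed scalar is coordinate k of the quotient vector, so the update replaces that
coordinate of ĝ and leaves the others. -/
theorem metaStep_gHat {d : ℕ} (K : Set (E d)) (δ η : ℝ) (f : E d → ℝ) (k : Fin d)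
    (s : MetaState d) : (metaStep K δ η f k s).gHat
      = (diffQuot δ f s.wHat - s.gHat) k • EuclideanSpace.single k (1 : ℝ) + s.gHat := rfl

theorem metaStep_w {d : ℕ} (K : Set (E d)) (δ η : ℝ) (f : E d → ℝ) (k : Fin d)
    (s : MetaState d) : (metaStep K δ η f k s).w
      = proj K (s.w - η • ((d : ℝ) • (diffQuot δ f s.wHat - s.gHat) k •
          EuclideanSpace.single k (1 : ℝ) + s.gHat)) := by
  rw [smul_smul]
  rfl

theorem norm_add_sq_le_two {F : Type*} [SeminormedAddCommGroup F] (a b : F) :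
    ‖a + b‖ ^ 2 ≤ 2 * ‖a‖ ^ 2 + 2 * ‖b‖ ^ 2 := by
  have h := norm_add_le a b
  nlinarith [norm_nonneg (a + b), sq_nonneg (‖a‖ - ‖b‖)]

theorem norm_add_sq_le_weighted {F : Type*} [SeminormedAddCommGroup F] (a b : F) {c : ℝ}
    (hc : 0 < c) : ‖a + b‖ ^ 2 ≤ (1 + 1 / c) * ‖a‖ ^ 2 + (1 + c) * ‖b‖ ^ 2 := by
  have h := norm_add_le a b
  have h1 : ‖a + b‖ ^ 2 ≤ (‖a‖ + ‖b‖) ^ 2 := pow_le_pow_left₀ (norm_nonneg _) h 2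
  have h2 : 0 ≤ (‖a‖ - c * ‖b‖) ^ 2 / c := by positivity
  have h3 : (‖a‖ - c * ‖b‖) ^ 2 / c = 1 / c * ‖a‖ ^ 2 - 2 * ‖a‖ * ‖b‖ + c * ‖b‖ ^ 2 := by
    field_simp
    ring
  nlinarith

section OneRound

variable {d : ℕ} {Ω K : Set (E d)} {L G δ η : ℝ}

/-- The change of the difference quotients between two losses and two points. -/
theorem norm_diffQuot_sub_diffQuot_sq_le (hL : 0 ≤ L) (hδ : 0 < δ) (hK : IsCore δ K Ω)
    {f f' : E d → ℝ} (hf : RegularLoss L G Ω f) (hf' : RegularLoss L G Ω f') {q : ℝ}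
    (hq : ∀ w ∈ Ω, ‖gradientWithin f' Ω w - gradientWithin f Ω w‖ ^ 2 ≤ q)
    {x x' : E d} (hx : x ∈ K) (hx' : x' ∈ K) :
    ‖diffQuot δ f' x' - diffQuot δ f x‖ ^ 2
      ≤ 2 * L ^ 2 * ‖x' - x‖ ^ 2 + (4 * q + 4 * d * L ^ 2 * δ ^ 2) := by
  have e := norm_diffQuot_sub_gradientWithin_le hL hδ hf.convexOn hf.smooth (hK.subset hx)
    (hK.add_mem x hx) (hK.sub_mem x hx)
  have e' := norm_diffQuot_sub_gradientWithin_le hL hδ hf'.convexOn hf'.smooth (hK.subset hx')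
    (hK.add_mem x' hx') (hK.sub_mem x' hx')
  have hm := hf.smooth.2 x' (hK.subset hx') x (hK.subset hx)
  have hq := hq x' (hK.subset hx')
  set a := gradientWithin f Ω x' - gradientWithin f Ω x
  set b := gradientWithin f' Ω x' - gradientWithin f Ω x'
  set c := diffQuot δ f' x' - gradientWithin f' Ω x' - (diffQuot δ f x - gradientWithin f Ω x)
    with hc
  have hsum : diffQuot δ f' x' - diffQuot δ f x = a + (b + c) := by
    simp only [a, b, c]; abel
  have hcn : ‖c‖ ≤ √d * (L * δ) := by
    calc ‖c‖ ≤ _ := norm_sub_le _ _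
      _ ≤ √d * (L * δ / 2) + √d * (L * δ / 2) := add_le_add e' e
      _ = _ := by ring
  have hc2 : ‖c‖ ^ 2 ≤ d * L ^ 2 * δ ^ 2 := by
    calc ‖c‖ ^ 2 ≤ (√d * (L * δ)) ^ 2 := pow_le_pow_left₀ (norm_nonneg _) hcn 2
      _ = _ := by rw [mul_pow, Real.sq_sqrt (Nat.cast_nonneg d)]; ring
  have ha2 : ‖a‖ ^ 2 ≤ L ^ 2 * ‖x' - x‖ ^ 2 := by
    calc ‖a‖ ^ 2 ≤ (L * ‖x' - x‖) ^ 2 := pow_le_pow_left₀ (norm_nonneg _) hm 2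
      _ = _ := by ring
  rw [hsum]
  linarith [norm_add_sq_le_two a (b + c), norm_add_sq_le_two b c]

/-- The excess loss of a round against the linearized loss. -/
theorem query_loss_sub_le (hL : 0 ≤ L) (hG : 0 ≤ G) (hδ : 0 < δ) (hK : IsCore δ K Ω)
    {f : E d → ℝ} (hf : RegularLoss L G Ω f) {r ε : ℝ} {u v : E d} (hu : u ∈ Ω) (hv : v ∈ Ω)
    (huv : ‖u - v‖ ≤ ε) {s : MetaState d} (hs : s.wHat ∈ K) (hr : ‖s.wHat - u‖ ≤ r) (k : Fin d) :
    (f (queryPlus δ s k) + f (queryMinus δ s k)) / 2 - f v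
      ≤ inner ℝ (diffQuot δ f s.wHat) (s.wHat - u) + G * (δ + ε) + √d * (L * δ / 2) * r := by
  have hx := hK.subset hs
  have hp := le_of_abs_le (hf.lipschitz _ (hK.add_mem _ hs k) _ hx)
  have hm := le_of_abs_le (hf.lipschitz _ (hK.sub_mem _ hs k) _ hx)
  have huv' := le_of_abs_le (hf.lipschitz _ hu _ hv)
  have hne : ‖δ • (EuclideanSpace.single k (1 : ℝ) : E d)‖ = δ := by
    rw [norm_smul]; simp [abs_of_pos hδ]
  rw [add_sub_cancel_left, hne] at hp
  rw [sub_sub_cancel_left, norm_neg, hne] at hm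
  have hc := add_inner_gradientWithin_le hf.convexOn hf.smooth.1 hx hu
  have e := norm_diffQuot_sub_gradientWithin_le hL hδ hf.convexOn hf.smooth hx
    (hK.add_mem _ hs) (hK.sub_mem _ hs)
  have h1 : -(√d * (L * δ / 2) * r)
      ≤ inner ℝ (diffQuot δ f s.wHat - gradientWithin f Ω s.wHat) (s.wHat - u) := by
    refine neg_le_of_abs_le ((abs_real_inner_le_norm _ _).trans ?_)
    exact mul_le_mul e hr (norm_nonneg _) (by positivity)
  rw [inner_sub_left] at h1
  rw [← neg_sub s.wHat u, inner_neg_right] at hc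
  have h2 := mul_le_mul_of_nonneg_left huv hG
  unfold queryPlus queryMinus
  linarith

/-- The averaged decrease of the potential in one round. -/
theorem sum_loss_add_potential_le (hd : 1 ≤ d) (hL : 0 ≤ L) (hG : 0 ≤ G) (hδ : 0 < δ)
    (hη : 0 < η) (hηL : 96 * η ^ 2 * (d : ℝ) ^ 3 * L ^ 2 ≤ 1) (hK : IsCore δ K Ω)
    {f f' : E d → ℝ} (hf : RegularLoss L G Ω f) (hf' : RegularLoss L G Ω f') {q : ℝ} (_ : 0 ≤ q)
    (hq : ∀ w ∈ Ω, ‖gradientWithin f' Ω w - gradientWithin f Ω w‖ ^ 2 ≤ q)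
    {r ε : ℝ} {u u' v : E d} (hu : u ∈ K) (hv : v ∈ Ω) (huv : ‖u - v‖ ≤ ε)
    (hr : ∀ x ∈ K, ‖x - u‖ ≤ r) (hr' : ∀ x ∈ K, ‖x - u'‖ ≤ r)
    {s : MetaState d} (hs : IsReachable K η s) :
    (∑ k, (((f (queryPlus δ s k) + f (queryMinus δ s k)) / 2 - f v)
        + potential δ η f' u' (metaStep K δ η f k s))) / d
      ≤ potential δ η f u s + (G * (δ + ε) + √d * (L * δ / 2) * r + r * ‖u - u'‖ / η
        + 24 * η * (d : ℝ) ^ 3 * (q + d * L ^ 2 * δ ^ 2)) := by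
  have hd0 : (0 : ℝ) < d := by exact_mod_cast hd
  have hd1 : (1 : ℝ) ≤ d := by exact_mod_cast hd
  set V := diffQuot δ f s.wHat with hV
  set x := V - s.gHat with hx
  set z := s.wHat - u with hz
  set c := G * (δ + ε) + √d * (L * δ / 2) * r + r * ‖u - u'‖ / η
        + 24 * η * (d : ℝ) ^ 3 * (q + d * L ^ 2 * δ ^ 2) with hc
  -- The dependence on k is isolated in three terms whose sums over k are known exactly. The term
  -- ⟨x, z⟩ is kept apart because the average of the first of them cancels it.
  have hround : ∀ k, ((f (queryPlus δ s k) + f (queryMinus δ s k)) / 2 - f v)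
        + potential δ η f' u' (metaStep K δ η f k s)
      ≤ (c + ‖s.w - u‖ ^ 2 / (2 * η) - ‖s.wHat - s.w‖ ^ 2 / (4 * η) + inner ℝ x z)
        - d * inner ℝ (x k • EuclideanSpace.single k (1 : ℝ)) z
        + η * d ^ 2 * ‖x k • (EuclideanSpace.single k (1 : ℝ) : E d)‖ ^ 2
        + (2 * η * d ^ 2 + η * d) * ‖x - x k • EuclideanSpace.single k (1 : ℝ)‖ ^ 2 := by
    intro k
    set y : E d := x k • EuclideanSpace.single k (1 : ℝ) with hy
    set s' := metaStep K δ η f k s with hs'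
    have hR : IsReachable K η s' := isReachable_metaStep hK.isClosed ⟨u, hu⟩ _ _ _ _ _
    have hw' : IsProj K (s.w - η • ((d : ℝ) • y + s.gHat)) s'.w := by
      rw [hs', metaStep_w]; exact isProj_proj hK.isClosed ⟨u, hu⟩ _
    have hg' : s'.gHat = y + s.gHat := metaStep_gHat K δ η f k s
    have h1 := query_loss_sub_le hL hG hδ hK hf (hK.subset hu) hv huv hs.wHat_mem
      (hr _ hs.wHat_mem) k
    have h2 := optimistic_step (hw'.inner_le_zero hK.convex hu)
      (hs.isProj.inner_le_zero hK.convex hR.w_mem)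
    have h3 := sq_dist_comparator_le (hr _ hR.w_mem) (hr' _ hR.w_mem)
    have h4 := norm_diffQuot_sub_diffQuot_sq_le hL hδ hK hf hf' hq hs.wHat_mem hR.wHat_mem
    -- The weight 2d inflates the old error by 1 + 1/(2d) only, which uses half of the contraction 1
    -- - 1/d; the other half pays for the variance.
    have h5 := norm_add_sq_le_weighted (x - y) (diffQuot δ f' s'.wHat - V)
      (by positivity : (0 : ℝ) < 2 * d)
    have h6 := norm_add_sq_le_two (s'.wHat - s'.w) (s'.w - s.wHat)
    have e5 : x - y + (diffQuot δ f' s'.wHat - V) = diffQuot δ f' s'.wHat - s'.gHat := by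
      rw [hg', hx]; abel
    rw [e5] at h5
    rw [sub_add_sub_cancel] at h6
    rw [← hV, ← hz] at h1
    rw [← hz, add_sub_cancel_right, inner_add_left, real_inner_smul_left, norm_smul,
      mul_pow, Real.norm_eq_abs, sq_abs] at h2
    have h2' : d * inner ℝ y z + inner ℝ s.gHat z
        ≤ ‖s.w - u‖ ^ 2 / (2 * η) - ‖s'.w - u‖ ^ 2 / (2 * η) + η * (d ^ 2 * ‖y‖ ^ 2)
          - ‖s'.w - s.wHat‖ ^ 2 / (4 * η) - ‖s.wHat - s.w‖ ^ 2 / (2 * η) := by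
      refine le_of_mul_le_mul_left (h2.trans_eq ?_) hη
      field_simp
    have h3' : ‖s'.w - u'‖ ^ 2 / (2 * η) - ‖s'.w - u‖ ^ 2 / (2 * η) ≤ r * ‖u - u'‖ / η := by
      have := div_le_div_of_nonneg_right h3 hη.le
      refine le_trans (le_of_eq ?_) this
      field_simp
    -- the movement terms are absorbed by the negative quadratic terms
    have hcoef : 24 * η * d ^ 3 * L ^ 2 ≤ 1 / (4 * η) := by
      rw [le_div_iff₀ (by positivity)]
      linarith
    have h7 : 2 * η * d ^ 2 * ‖diffQuot δ f' s'.wHat - s'.gHat‖ ^ 2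
        ≤ (2 * η * d ^ 2 + η * d) * ‖x - y‖ ^ 2
          + (‖s'.wHat - s'.w‖ ^ 2 + ‖s'.w - s.wHat‖ ^ 2) / (4 * η)
          + 24 * η * (d : ℝ) ^ 3 * (q + d * L ^ 2 * δ ^ 2) := by
      have hM : ‖diffQuot δ f' s'.wHat - V‖ ^ 2
          ≤ 4 * L ^ 2 * (‖s'.wHat - s'.w‖ ^ 2 + ‖s'.w - s.wHat‖ ^ 2)
            + 4 * (q + d * L ^ 2 * δ ^ 2) := by
        have := mul_le_mul_of_nonneg_left h6 (by positivity : 0 ≤ 2 * L ^ 2)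
        linarith
      calc 2 * η * d ^ 2 * ‖diffQuot δ f' s'.wHat - s'.gHat‖ ^ 2
          ≤ 2 * η * d ^ 2 * ((1 + 1 / (2 * d)) * ‖x - y‖ ^ 2
            + (1 + 2 * d) * ‖diffQuot δ f' s'.wHat - V‖ ^ 2) := by gcongr
        _ = (2 * η * d ^ 2 + η * d) * ‖x - y‖ ^ 2
            + 2 * η * d ^ 2 * (1 + 2 * d) * ‖diffQuot δ f' s'.wHat - V‖ ^ 2 := by
          field_simp
        _ ≤ (2 * η * d ^ 2 + η * d) * ‖x - y‖ ^ 2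
            + 2 * η * d ^ 2 * (d + 2 * d) *
              (4 * L ^ 2 * (‖s'.wHat - s'.w‖ ^ 2 + ‖s'.w - s.wHat‖ ^ 2)
                + 4 * (q + d * L ^ 2 * δ ^ 2)) := by gcongr
        _ = (2 * η * d ^ 2 + η * d) * ‖x - y‖ ^ 2
            + 24 * η * d ^ 3 * L ^ 2 * (‖s'.wHat - s'.w‖ ^ 2 + ‖s'.w - s.wHat‖ ^ 2)
            + 24 * η * (d : ℝ) ^ 3 * (q + d * L ^ 2 * δ ^ 2) := by ring
        _ ≤ (2 * η * d ^ 2 + η * d) * ‖x - y‖ ^ 2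
            + 1 / (4 * η) * (‖s'.wHat - s'.w‖ ^ 2 + ‖s'.w - s.wHat‖ ^ 2)
            + 24 * η * (d : ℝ) ^ 3 * (q + d * L ^ 2 * δ ^ 2) := by gcongr
        _ = _ := by ring
    have h8 : ‖s.wHat - s.w‖ ^ 2 / (4 * η) ≤ ‖s.wHat - s.w‖ ^ 2 / (2 * η) := by
      gcongr; norm_num
    have h9 : inner ℝ V z = inner ℝ x z + inner ℝ s.gHat z := by
      rw [← inner_add_left, hx, sub_add_cancel]
    rw [add_div] at h7
    unfold potential
    linarith
  have hsum := Finset.sum_le_sum fun k (_ : k ∈ Finset.univ) => hround k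
  rw [div_le_iff₀ hd0]
  refine hsum.trans ?_
  simp only [Finset.sum_add_distrib, Finset.sum_sub_distrib, ← Finset.mul_sum, sum_inner_single,
    sum_norm_sq_single, sum_norm_sq_sub_single, Finset.sum_const, Finset.card_univ,
    Fintype.card_fin, nsmul_eq_mul]
  unfold potential
  rw [← hV, ← hx]
  -- On average the coefficient of ‖x‖² is ηd + (2ηd² + ηd)(1 - 1/d) = 2ηd² - η, below the 2ηd² of
  -- the old potential.
  nlinarith [mul_nonneg (mul_nonneg hη.le hd0.le) (sq_nonneg ‖x‖)]

end OneRound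

/-! ### The regret bound for a general step size -/

/-- A query point is a convex combination (1 - ξ)y + ξb with y in Ω and b in the ball of radius R₁.
-/
theorem isCore_shrink {d : ℕ} {Ω : Set (E d)} (hcl : IsClosed Ω) (hcv : Convex ℝ Ω) {R₁ ξ : ℝ}
    (hR₁ : 0 ≤ R₁) (hball : Metric.closedBall 0 R₁ ⊆ Ω) (hξ0 : 0 ≤ ξ) (hξ1 : ξ < 1) :
    IsCore (ξ * R₁) ((1 - ξ) • Ω) Ω := by
  have hmix : ∀ x ∈ (1 - ξ) • Ω, ∀ b : E d, ‖b‖ ≤ R₁ → x + ξ • b ∈ Ω := by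
    rintro _ ⟨y, hy, rfl⟩ b hb
    exact hcv hy (hball (by simpa using hb)) (by linarith) hξ0 (by ring)
  refine ⟨hcl.smul₀ _, hcv.smul _, fun x hx => by simpa using hmix x hx 0 (by simpa using hR₁),
    fun x hx k => ?_, fun x hx k => ?_⟩
  · rw [mul_smul]
    exact hmix x hx _ (by rw [norm_smul]; simp [abs_of_nonneg hR₁])
  · rw [mul_smul, sub_eq_add_neg, ← smul_neg]
    exact hmix x hx _ (by rw [norm_neg, norm_smul]; simp [abs_of_nonneg hR₁])

theorem sum_Icc_one_eq_sum_range (F : ℕ → ℝ) (T : ℕ) :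
    ∑ t ∈ Finset.Icc 1 T, F t = ∑ n ∈ Finset.range T, F (n + 1) := by
  rw [Finset.sum_bij' (fun t _ => t - 1) (fun n _ => n + 1)] <;> intro a ha <;>
    simp only [Finset.mem_Icc, Finset.mem_range] at ha ⊢ <;> first | omega | skip
  rw [Nat.sub_add_cancel ha.1]

/-- The hypotheses on domain, losses and comparators, apart from the variation budgets. -/
structure Setting {d : ℕ} (L G r R₁ : ℝ) (T : ℕ) (Ω : Set (E d)) (f : ℕ → E d → ℝ)
    (wStar : ℕ → E d) : Prop where
  one_le_dim : 1 ≤ d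
  two_le : 2 ≤ T
  L_pos : 0 < L
  R₁_pos : 0 < R₁
  isClosed : IsClosed Ω
  convex : Convex ℝ Ω
  ball_subset : Metric.closedBall 0 R₁ ⊆ Ω
  regular : ∀ t ∈ Finset.Icc 1 T, RegularLoss L G Ω (f t)
  dist_le : ∀ t ∈ Finset.Icc 1 T, ∀ w ∈ Ω, ‖w - wStar t‖ ≤ r
  mem : ∀ t ∈ Finset.Icc 1 T, wStar t ∈ Ω

namespace Setting

variable {d : ℕ} {L G r R₁ : ℝ} {T : ℕ} {Ω : Set (E d)} {f : ℕ → E d → ℝ} {wStar : ℕ → E d}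

theorem zero_mem (h : Setting L G r R₁ T Ω f wStar) : 0 ∈ Ω :=
  h.ball_subset (by simpa using h.R₁_pos.le)

/-- The sign is forced because Ω contains two distinct points, 0 and a multiple of a basis vector.
-/
theorem G_nonneg (h : Setting L G r R₁ T Ω f wStar) : 0 ≤ G := by
  have hT := h.two_le
  have hmem : R₁ • (EuclideanSpace.single ⟨0, h.one_le_dim⟩ (1 : ℝ) : E d) ∈ Ω := by
    apply h.ball_subset
    rw [mem_closedBall_zero_iff, norm_smul]
    simp [abs_of_pos h.R₁_pos]
  have h1 := (abs_nonneg _).trans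
    ((h.regular 1 (by simp; omega)).lipschitz _ hmem _ h.zero_mem)
  rw [sub_zero, norm_smul] at h1
  simp only [Real.norm_eq_abs, abs_of_pos h.R₁_pos, PiLp.norm_single, abs_one, mul_one] at h1
  exact nonneg_of_mul_nonneg_left h1 h.R₁_pos

theorem inv_pos (h : Setting L G r R₁ T Ω f wStar) : 0 < 1 / (T : ℝ) := by
  have := h.two_le
  positivity

theorem inv_lt_one (h : Setting L G r R₁ T Ω f wStar) : 1 / (T : ℝ) < 1 := by
  have h2 : (2 : ℝ) ≤ T := by exact_mod_cast h.two_le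
  rw [div_lt_one (by linarith)]
  linarith

theorem isCore (h : Setting L G r R₁ T Ω f wStar) :
    IsCore (1 / (T : ℝ) * R₁) ((1 - 1 / (T : ℝ)) • Ω) Ω :=
  isCore_shrink h.isClosed h.convex h.R₁_pos.le h.ball_subset h.inv_pos.le h.inv_lt_one

theorem zero_mem_core (h : Setting L G r R₁ T Ω f wStar) : 0 ∈ (1 - 1 / (T : ℝ)) • Ω :=
  ⟨0, h.zero_mem, by simp⟩

variable {P : Type*} [MeasurableSpace P] {μ : Measure P} [IsProbabilityMeasure μ]
  {i : ℕ → P → Fin d}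

/-- The potential argument applied to the run of the algorithm. -/
theorem integral_metaLoss_le {η : ℝ} (hi : IsUniformIID μ i)
    {Ψ : ℕ → MetaState d → ℝ} {c : ℕ → ℝ} {m : ℝ}
    (hstep : ∀ n < T, ∀ j, (∑ k,
      ((f (n + 1) (queryPlus (1 / (T : ℝ) * R₁)
            (metaRun ((1 - 1 / (T : ℝ)) • Ω) (1 / (T : ℝ) * R₁) η f j n) k)
          + f (n + 1) (queryMinus (1 / (T : ℝ) * R₁)
            (metaRun ((1 - 1 / (T : ℝ)) • Ω) (1 / (T : ℝ) * R₁) η f j n) k)) / 2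
          - f (n + 1) (wStar (n + 1))
        + Ψ (n + 1) (metaStep ((1 - 1 / (T : ℝ)) • Ω) (1 / (T : ℝ) * R₁) η (f (n + 1)) k
            (metaRun ((1 - 1 / (T : ℝ)) • Ω) (1 / (T : ℝ) * R₁) η f j n)))) / d
      ≤ Ψ n (metaRun ((1 - 1 / (T : ℝ)) • Ω) (1 / (T : ℝ) * R₁) η f j n) + c n)
    (hm : ∀ j, -m ≤ Ψ T (metaRun ((1 - 1 / (T : ℝ)) • Ω) (1 / (T : ℝ) * R₁) η f j T)) :
    ∫ ω, metaLoss Ω R₁ η T f (fun t => i t ω) ∂μ - ∑ t ∈ Finset.Icc 1 T, f t (wStar t)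
      ≤ Ψ 0 ⟨0, 0, 0⟩ + ∑ n ∈ Finset.range T, c n + m := by
  set K := (1 - 1 / (T : ℝ)) • Ω with hK
  set δ := 1 / (T : ℝ) * R₁ with hδ
  have hX₀ : ∀ j, metaRun K δ η f j 0 = ⟨0, 0, 0⟩ := fun j => rfl
  have hX : ∀ j n, metaRun K δ η f j (n + 1)
      = metaStep K δ η (f (n + 1)) (j (n + 1)) (metaRun K δ η f j n) := fun j n => rfl
  have hloss : ∀ j : ℕ → Fin d, metaLoss Ω R₁ η T f j = ∑ n ∈ Finset.range T,
      (f (n + 1) (queryPlus δ (metaRun K δ η f j n) (j (n + 1)))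
        + f (n + 1) (queryMinus δ (metaRun K δ η f j n) (j (n + 1)))) / 2 := by
    intro j
    simp only [metaLoss, sum_Icc_one_eq_sum_range, add_tsub_cancel_right]
    rfl
  have hint : Integrable (fun ω => metaLoss Ω R₁ η T f (fun t => i t ω)) μ := by
    simp_rw [hloss]
    exact integrable_of_dependsOn hi.1 (dependsOn_sum_recursion hX₀ hX
      (ℓ := fun n k s => (f (n + 1) (queryPlus δ s k) + f (n + 1) (queryMinus δ s k)) / 2) T)
  have h := integral_sum_le_of_potential (μ := μ) hi hX₀ hX
    (ℓ := fun n k s => (f (n + 1) (queryPlus δ s k) + f (n + 1) (queryMinus δ s k)) / 2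
      - f (n + 1) (wStar (n + 1))) hstep hm
  refine le_trans (le_of_eq ?_) h
  simp_rw [Finset.sum_sub_distrib, ← hloss]
  rw [integral_sub hint (integrable_const _), integral_const, probReal_univ, one_smul,
    sum_Icc_one_eq_sum_range]

/-- Without any assumption on the step size the regret is at most linear in `T`. -/
theorem regret_le_linear (h : Setting L G r R₁ T Ω f wStar) (η : ℝ) (hi : IsUniformIID μ i) :
    ∫ ω, metaLoss Ω R₁ η T f (fun t => i t ω) ∂μ - ∑ t ∈ Finset.Icc 1 T, f t (wStar t)
      ≤ T * (G * r) := by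
  have hd0 : (0 : ℝ) < d := by exact_mod_cast h.one_le_dim
  have := integral_metaLoss_le (Ω := Ω) (R₁ := R₁) (f := f) (wStar := wStar) (T := T) (η := η)
    (μ := μ) hi (Ψ := fun _ _ => 0) (c := fun _ => G * r) (m := 0) ?_ (fun _ => by simp)
  · simpa using this
  · intro n hn j
    have ht : n + 1 ∈ Finset.Icc 1 T := by simp; omega
    have hs := isReachable_metaRun h.isCore.isClosed h.zero_mem_core (1 / (T : ℝ) * R₁) η f j n
    have hle : ∀ x ∈ Ω, f (n + 1) x - f (n + 1) (wStar (n + 1)) ≤ G * r := fun x hx =>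
      (le_of_abs_le ((h.regular _ ht).lipschitz _ hx _ (h.mem _ ht))).trans
        (mul_le_mul_of_nonneg_left (h.dist_le _ ht x hx) h.G_nonneg)
    rw [div_le_iff₀ hd0, zero_add]
    refine (Finset.sum_le_card_nsmul _ _ (G * r) fun k _ => ?_).trans_eq (by simp [mul_comm])
    have h1 := hle _ (h.isCore.add_mem _ hs.wHat_mem k)
    have h2 := hle _ (h.isCore.sub_mem _ hs.wHat_mem k)
    unfold queryPlus queryMinus
    linarith

/-- Path variation bounds the movement of any choice of minimizers. -/
theorem sum_norm_sub_le_of_pathVariation_le {B : ℝ≥0} (hB : pathVariation Ω f T ≤ (B : ℝ≥0∞))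
    (hw : ∀ t ∈ Finset.Icc 1 T, wStar t ∈ minimizers Ω (f t)) :
    ∑ t ∈ Finset.Ico 1 T, ‖wStar t - wStar (t + 1)‖ ≤ B := by
  have h1 : ∑ t ∈ Finset.Ico 1 T, ‖wStar t - wStar (t + 1)‖ₑ ≤ (B : ℝ≥0∞) :=
    (le_iSup₂ (f := fun (w : ℕ → E d) (_ : ∀ t ∈ Finset.Icc 1 T, w t ∈ minimizers Ω (f t)) =>
      ∑ t ∈ Finset.Ico 1 T, ‖w t - w (t + 1)‖ₑ) wStar hw).trans hB
  have h2 := ENNReal.toReal_mono ENNReal.coe_ne_top h1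
  rw [ENNReal.toReal_sum fun _ _ => enorm_ne_top] at h2
  simpa using h2

/-- Gradient variation bounds the squared gradient differences round by round. -/
theorem exists_gradient_budget {S : ℝ≥0} (hS : gradientVariation Ω f T ≤ (S : ℝ≥0∞)) :
    ∃ a : ℕ → ℝ, (∀ t, 0 ≤ a t) ∧ ∑ t ∈ Finset.Icc 1 T, a t ≤ S ∧
      ∀ t ∈ Finset.Icc 1 T, ∀ w ∈ Ω,
        ‖gradientWithin (f t) Ω w - gradientWithin (f (t - 1)) Ω w‖ ^ 2 ≤ a t := by
  set b : ℕ → ℝ≥0∞ := fun t =>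
    ⨆ w ∈ Ω, ‖gradientWithin (f t) Ω w - gradientWithin (f (t - 1)) Ω w‖ₑ ^ 2 with hb
  have hsum : ∑ t ∈ Finset.Icc 1 T, b t ≤ (S : ℝ≥0∞) := hS
  have hfin : ∀ t ∈ Finset.Icc 1 T, b t ≠ ⊤ := fun t ht =>
    ((Finset.single_le_sum (fun _ _ => zero_le) ht).trans hsum).trans_lt
      ENNReal.coe_lt_top |>.ne
  refine ⟨fun t => (b t).toReal, fun t => ENNReal.toReal_nonneg, ?_, fun t ht w hw => ?_⟩
  · rw [← ENNReal.toReal_sum hfin]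
    simpa using ENNReal.toReal_mono ENNReal.coe_ne_top hsum
  · have h1 : ‖gradientWithin (f t) Ω w - gradientWithin (f (t - 1)) Ω w‖ₑ ^ 2 ≤ b t :=
      le_iSup₂ (f := fun w (_ : w ∈ Ω) =>
        ‖gradientWithin (f t) Ω w - gradientWithin (f (t - 1)) Ω w‖ₑ ^ 2) w hw
    simpa using ENNReal.toReal_mono (hfin t ht) h1

/-- The regret bound for every step size below the smoothness threshold. -/
theorem regret_le (h : Setting L G r R₁ T Ω f wStar) {B S η : ℝ} (hη : 0 < η)
    (hηL : 96 * η ^ 2 * (d : ℝ) ^ 3 * L ^ 2 ≤ 1)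
    (hB : ∑ t ∈ Finset.Ico 1 T, ‖wStar t - wStar (t + 1)‖ ≤ B)
    {a : ℕ → ℝ} (ha0 : ∀ t, 0 ≤ a t) (haS : ∑ t ∈ Finset.Icc 1 T, a t ≤ S)
    (ha : ∀ t ∈ Finset.Icc 1 T, ∀ w ∈ Ω,
      ‖gradientWithin (f t) Ω w - gradientWithin (f (t - 1)) Ω w‖ ^ 2 ≤ a t)
    (hi : IsUniformIID μ i) :
    ∫ ω, metaLoss Ω R₁ η T f (fun t => i t ω) ∂μ - ∑ t ∈ Finset.Icc 1 T, f t (wStar t)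
      ≤ (3 / 2 * r ^ 2 + r * B) / η + 24 * η * (d : ℝ) ^ 3 * S
        + 24 * η * (d : ℝ) ^ 4 * L ^ 2 * R₁ ^ 2 / T + 2 * η * (d : ℝ) ^ 3 * G ^ 2
        + √d * (L * R₁ * r / 2) + G * (R₁ + r) := by
  obtain ⟨N, rfl⟩ : ∃ N, T = N + 1 := ⟨T - 1, by have := h.two_le; omega⟩
  set T := N + 1 with hT
  have hT0 : (0 : ℝ) < T := by positivity
  set ξ := 1 / (T : ℝ) with hξ
  set δ := ξ * R₁ with hδ
  set K := (1 - ξ) • Ω with hKdef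
  have hξ0 : 0 < ξ := h.inv_pos
  have hξ1 : ξ < 1 := h.inv_lt_one
  have hK : IsCore δ K Ω := h.isCore
  have h0K : (0 : E d) ∈ K := h.zero_mem_core
  have hδ0 : 0 < δ := mul_pos hξ0 h.R₁_pos
  have hG := h.G_nonneg
  have hr : 0 ≤ r := (norm_nonneg _).trans (h.dist_le 1 (by simp [hT]) 0 h.zero_mem)
  have hcap : ∀ n, min (n + 1) T ∈ Finset.Icc 1 T := fun n => by simp [hT]
  -- Comparators are shrunk so as to lie in K, at cost Gξr per round. The potential after the last
  -- round needs a loss and a comparator for round T + 1; the clamped index repeats those of round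
  -- T, so no variation is added there.
  set u : ℕ → E d := fun n => (1 - ξ) • wStar (min (n + 1) T) with hu
  set F : ℕ → E d → ℝ := fun n => f (min (n + 1) T) with hF
  set q : ℕ → ℝ := fun n => if n < N then a (n + 2) else 0 with hq
  have huK : ∀ n, u n ∈ K := fun n => ⟨_, h.mem _ (hcap n), rfl⟩
  have hur : ∀ n, ∀ x ∈ K, ‖x - u n‖ ≤ r := by
    rintro n _ ⟨y, hy, rfl⟩
    change ‖(1 - ξ) • y - (1 - ξ) • wStar (min (n + 1) T)‖ ≤ r
    rw [← smul_sub, norm_smul, Real.norm_eq_abs, abs_of_pos (by linarith)]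
    have := h.dist_le _ (hcap n) y hy
    nlinarith [norm_nonneg (y - wStar (min (n + 1) T))]
  have hq0 : ∀ n, 0 ≤ q n := fun n => by
    simp only [hq]; split_ifs
    · exact ha0 _
    · exact le_rfl
  have hmain := integral_metaLoss_le (Ω := Ω) (R₁ := R₁) (f := f) (wStar := wStar) (T := T)
    (η := η) (μ := μ) hi (Ψ := fun n => potential δ η (F n) (u n))
    (c := fun n => G * (δ + ξ * r) + √d * (L * δ / 2) * r + r * ‖u n - u (n + 1)‖ / η
        + 24 * η * (d : ℝ) ^ 3 * (q n + d * L ^ 2 * δ ^ 2)) (m := r ^ 2 / η) ?_ ?_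
  · refine hmain.trans ?_
    have hstart : potential δ η (F 0) (u 0) ⟨0, 0, 0⟩
        ≤ r ^ 2 / (2 * η) + 2 * η * d ^ 3 * G ^ 2 := by
      have h1 := hur 0 0 h0K
      have h2 := norm_diffQuot_le hG hδ0 (h.regular _ (hcap 0)).lipschitz
        (hK.add_mem 0 h0K) (hK.sub_mem 0 h0K)
      have h3 : ‖diffQuot δ (F 0) 0‖ ^ 2 ≤ d * G ^ 2 := by
        calc _ ≤ (√d * G) ^ 2 := pow_le_pow_left₀ (norm_nonneg _) h2 2
          _ = _ := by rw [mul_pow, Real.sq_sqrt (Nat.cast_nonneg d)]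
      unfold potential
      rw [sub_zero, sub_self, norm_zero]
      calc _ = ‖0 - u 0‖ ^ 2 / (2 * η) + 2 * η * d ^ 2 * ‖diffQuot δ (F 0) 0‖ ^ 2 := by simp
        _ ≤ r ^ 2 / (2 * η) + 2 * η * d ^ 2 * (d * G ^ 2) := by gcongr
        _ = _ := by ring
    have hpath : ∑ n ∈ Finset.range T, ‖u n - u (n + 1)‖ ≤ B := by
      refine le_trans ?_ hB
      rw [hT, Finset.sum_range_succ, Finset.sum_Ico_eq_sum_range]
      have hlast : ‖u N - u (N + 1)‖ = 0 := by simp [hu, hT]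
      rw [hlast, add_zero, Nat.add_sub_cancel]
      refine Finset.sum_le_sum fun n hn => ?_
      rw [Finset.mem_range] at hn
      have e1 : min (n + 1) T = 1 + n := by omega
      have e2 : min (n + 1 + 1) T = 1 + n + 1 := by omega
      simp only [hu, e1, e2]
      rw [← smul_sub, norm_smul, Real.norm_eq_abs, abs_of_pos (by linarith)]
      nlinarith [norm_nonneg (wStar (1 + n) - wStar (1 + n + 1))]
    have hgrad : ∑ n ∈ Finset.range T, q n ≤ S := by
      refine le_trans ?_ haS
      rw [sum_Icc_one_eq_sum_range, hT, Finset.sum_range_succ, Finset.sum_range_succ']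
      have hlast : q N = 0 := by simp [hq]
      rw [hlast]
      -- The term comparing the first loss with `f 0` is not needed and is discarded.
      refine add_le_add (Finset.sum_le_sum fun n hn => ?_) (ha0 _)
      simp only [hq, if_pos (Finset.mem_range.1 hn)]
      exact le_rfl
    have hTδ : (T : ℝ) * δ = R₁ := by rw [hδ, hξ]; field_simp
    have hTξ : (T : ℝ) * ξ = 1 := by rw [hξ]; field_simp
    have hTδ2 : (T : ℝ) * δ ^ 2 = R₁ ^ 2 / T := by rw [hδ, hξ]; field_simp
    have hsum : ∑ n ∈ Finset.range T, (G * (δ + ξ * r) + √d * (L * δ / 2) * r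
          + r * ‖u n - u (n + 1)‖ / η + 24 * η * (d : ℝ) ^ 3 * (q n + d * L ^ 2 * δ ^ 2))
        = G * (T * δ + T * ξ * r) + √d * (L * (T * δ) / 2) * r
          + r * (∑ n ∈ Finset.range T, ‖u n - u (n + 1)‖) / η
          + 24 * η * (d : ℝ) ^ 3 * (∑ n ∈ Finset.range T, q n + d * L ^ 2 * (T * δ ^ 2)) := by
      simp only [Finset.sum_add_distrib, Finset.sum_const, Finset.card_range, nsmul_eq_mul,
        Finset.mul_sum, Finset.sum_div, mul_add]
      ring
    rw [hsum, hTδ, hTξ, hTδ2]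
    have h1 : r * (∑ n ∈ Finset.range T, ‖u n - u (n + 1)‖) / η ≤ r * B / η := by gcongr
    have h2 : 24 * η * (d : ℝ) ^ 3 * (∑ n ∈ Finset.range T, q n + d * L ^ 2 * (R₁ ^ 2 / T))
        ≤ 24 * η * (d : ℝ) ^ 3 * (S + d * L ^ 2 * (R₁ ^ 2 / T)) := by gcongr
    -- Half of r²/η comes from the initial potential, a whole one from the lower bound on the final
    -- potential.
    have e : (3 / 2 * r ^ 2 + r * B) / η = r ^ 2 / (2 * η) + r * B / η + r ^ 2 / η := by
      field_simp; ring
    have e' : 24 * η * (d : ℝ) ^ 3 * (S + d * L ^ 2 * (R₁ ^ 2 / T))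
        = 24 * η * (d : ℝ) ^ 3 * S + 24 * η * (d : ℝ) ^ 4 * L ^ 2 * R₁ ^ 2 / T := by ring
    rw [e]
    rw [e'] at h2
    linarith
  · intro n hn j
    have e1 : min (n + 1) T = n + 1 := by omega
    have ht : n + 1 ∈ Finset.Icc 1 T := by simp; omega
    have hFn : F n = f (n + 1) := by simp only [hF, e1]
    have hs := isReachable_metaRun hK.isClosed h0K δ η f j n
    have hqn : ∀ w ∈ Ω, ‖gradientWithin (F (n + 1)) Ω w - gradientWithin (F n) Ω w‖ ^ 2
        ≤ q n := by
      intro w hw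
      by_cases hnN : n < N
      · have e2 : min (n + 1 + 1) T = n + 2 := by omega
        simp only [hF, e1, e2, hq, if_pos hnN]
        exact ha (n + 2) (by simp; omega) w hw
      · have e2 : min (n + 1 + 1) T = n + 1 := by omega
        simp [hF, e1, e2, hq, if_neg hnN]
    have huv : ‖u n - wStar (n + 1)‖ ≤ ξ * r := by
      have e : u n - wStar (n + 1) = ξ • (0 - wStar (n + 1)) := by
        simp only [hu, e1]; module
      rw [e, norm_smul, Real.norm_eq_abs, abs_of_pos hξ0]
      exact mul_le_mul_of_nonneg_left (h.dist_le _ ht 0 h.zero_mem) hξ0.le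
    have := sum_loss_add_potential_le h.one_le_dim h.L_pos.le hG hδ0 hη hηL hK
      (h.regular _ (hcap n)) (h.regular _ (hcap (n + 1))) (hq0 n) hqn (huK n) (h.mem _ ht) huv
      (hur n) (hur (n + 1)) hs
    rw [← hFn]
    rw [e1, ← hFn] at this
    exact this
  · intro j
    have hs := isReachable_metaRun hK.isClosed h0K δ η f j T
    set s := metaRun K δ η f j T
    -- Only the last term of the potential is negative, and both points lie within r of a common
    -- comparator.
    have h1 : ‖s.wHat - s.w‖ ≤ 2 * r := by
      rw [← sub_sub_sub_cancel_right _ _ (u 0)]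
      linarith [norm_sub_le (s.wHat - u 0) (s.w - u 0), hur 0 _ hs.w_mem, hur 0 _ hs.wHat_mem]
    have h2 : ‖s.wHat - s.w‖ ^ 2 / (4 * η) ≤ r ^ 2 / η := by
      calc _ ≤ (2 * r) ^ 2 / (4 * η) := by gcongr
        _ = _ := by field_simp; ring
    have h3 : 0 ≤ ‖s.w - u T‖ ^ 2 / (2 * η)
        + 2 * η * (d : ℝ) ^ 2 * ‖diffQuot δ (F T) s.wHat - s.gHat‖ ^ 2 := by positivity
    change _ ≤ potential δ η (F T) (u T) s
    unfold potential
    linarith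

end Setting

/-! ### Tuning the step size -/

/-- The constant of the tuned regret bound. -/
noncomputable def regretConst (L G r R₁ : ℝ) : ℝ :=
  30 * √(2 * r + r ^ 2) + 2 * (2 * r + r ^ 2) * L + 2 * L * R₁ ^ 2 + G ^ 2 / L + L * R₁ * r
    + |G| * (R₁ + r)

theorem regretConst_nonneg {L r R₁ : ℝ} (G : ℝ) (hL : 0 < L) (hr : 0 < r) (hR₁ : 0 < R₁) :
    0 ≤ regretConst L G r R₁ := by
  unfold regretConst
  positivity

section StepSize

variable {d : ℕ} {r B S cap : ℝ}

theorem stepSize_le_cap : stepSize d r B S cap ≤ cap := by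
  unfold stepSize
  split_ifs
  · exact le_rfl
  · exact min_le_right _ _

theorem stepSize_pos (hd : 1 ≤ d) (hr : 0 < r) (hB : 0 ≤ B) (hS : 0 ≤ S) (hcap : 0 < cap) :
    0 < stepSize d r B S cap := by
  unfold stepSize
  split_ifs with h
  · exact hcap
  · have hS' : 0 < S := lt_of_le_of_ne hS (Ne.symm h)
    have hd0 : (0 : ℝ) < d := by exact_mod_cast hd
    exact lt_min (Real.sqrt_pos.2 (by positivity)) hcap

/-- Dividing by a minimum costs at most the sum of the two quotients, while multiplying by it may
use the square root alone. The constant 3 rounds up √8. -/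
theorem stepSize_balance (hd : 1 ≤ d) (hr : 0 < r) (hB : 0 ≤ B) (hS : 0 ≤ S) (hcap : 0 < cap) :
    (2 * r * B + r ^ 2) / stepSize d r B S cap
        ≤ 3 * (d ^ 2 * √(S * (2 * r * B + r ^ 2))) + (2 * r * B + r ^ 2) / cap ∧
      stepSize d r B S cap * (d : ℝ) ^ 2 * S ≤ √(S * (2 * r * B + r ^ 2)) := by
  have hd0 : (0 : ℝ) < d := by exact_mod_cast hd
  set N := 2 * r * B + r ^ 2 with hN
  have hN0 : 0 < N := by positivity
  unfold stepSize
  split_ifs with h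
  · subst h
    simp
  have hS' : 0 < S := lt_of_le_of_ne hS (Ne.symm h)
  set A := √(N / (8 * S * (d : ℝ) ^ 4)) with hA
  have hA0 : 0 < A := Real.sqrt_pos.2 (by positivity)
  have hA2 : A ^ 2 * (8 * S * (d : ℝ) ^ 4) = N := by
    rw [hA, Real.sq_sqrt (by positivity)]
    field_simp
  set Y := √(S * N) with hY
  have hY0 : 0 < Y := Real.sqrt_pos.2 (by positivity)
  have hY2 : Y ^ 2 = S * N := Real.sq_sqrt (by positivity)
  constructor
  · have h1 : N / min A cap ≤ N / A + N / cap := by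
      rcases min_choice A cap with h | h <;> rw [h]
      · have : 0 ≤ N / cap := by positivity
        linarith
      · have : 0 ≤ N / A := by positivity
        linarith
    have h2 : N / A ≤ 3 * (d ^ 2 * Y) := by
      rw [div_le_iff₀ hA0]
      refine (sq_le_sq₀ hN0.le (by positivity)).1 ?_
      calc N ^ 2 = 8 * (A ^ 2 * S * N * d ^ 4) := by rw [← hA2]; ring
        _ ≤ 9 * (A ^ 2 * S * N * d ^ 4) := by gcongr; norm_num
        _ = 9 * (A ^ 2 * Y ^ 2 * d ^ 4) := by rw [hY2]; ring
        _ = _ := by ring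
    linarith
  · have h1 : A * (d : ℝ) ^ 2 * S ≤ Y := by
      refine (sq_le_sq₀ (by positivity) hY0.le).1 ?_
      rw [hY2, ← hA2]
      have : 0 ≤ A ^ 2 * d ^ 4 * S ^ 2 := by positivity
      nlinarith
    refine le_trans ?_ h1
    gcongr
    exact min_le_left _ _

end StepSize

theorem rpow_three_halves_sq {x : ℝ} (hx : 0 ≤ x) : (x ^ (3 / 2 : ℝ)) ^ 2 = x ^ 3 := by
  rw [← Real.rpow_natCast, ← Real.rpow_mul hx, ← Real.rpow_natCast]
  norm_num

theorem self_le_rpow_three_halves {x : ℝ} (hx : 1 ≤ x) : x ≤ x ^ (3 / 2 : ℝ) := by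
  simpa using Real.rpow_le_rpow_of_exponent_le hx (by norm_num : (1 : ℝ) ≤ 3 / 2)

set_option maxHeartbeats 1000000 in
/-- The tuned regret bound for a step size capped at `1 / (κ L d^{3/2})`. -/
theorem Setting.tuned_regret_le {d : ℕ} {L G r R₁ : ℝ} {T : ℕ} {Ω : Set (E d)}
    {f : ℕ → E d → ℝ} {wStar : ℕ → E d} (h : Setting L G r R₁ T Ω f wStar) (hr : 0 < r)
    {B S : ℝ} (hB0 : 0 ≤ B) (hS0 : 0 ≤ S)
    (hB : ∑ t ∈ Finset.Ico 1 T, ‖wStar t - wStar (t + 1)‖ ≤ B)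
    {a : ℕ → ℝ} (ha0 : ∀ t, 0 ≤ a t) (haS : ∑ t ∈ Finset.Icc 1 T, a t ≤ S)
    (ha : ∀ t ∈ Finset.Icc 1 T, ∀ w ∈ Ω,
      ‖gradientWithin (f t) Ω w - gradientWithin (f (t - 1)) Ω w‖ ^ 2 ≤ a t)
    {P : Type*} [MeasurableSpace P] {μ : Measure P} [IsProbabilityMeasure μ] {i : ℕ → P → Fin d}
    (hi : IsUniformIID μ i) {κ : ℝ} (hκ : 16 ≤ κ) :
    ∫ ω, metaLoss Ω R₁ (stepSize d r B S (1 / (κ * L * (d : ℝ) ^ (3 / 2 : ℝ)))) T f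
        (fun t => i t ω) ∂μ - ∑ t ∈ Finset.Icc 1 T, f t (wStar t)
      ≤ regretConst L G r R₁ * max ((d : ℝ) ^ 2 * √(S * max B 1))
          (κ * (d : ℝ) ^ (3 / 2 : ℝ) * max B 1) := by
  have hd1 : (1 : ℝ) ≤ d := by exact_mod_cast h.one_le_dim
  have hT0 : (0 : ℝ) < T := by have := h.two_le; positivity
  have hL := h.L_pos
  have hR₁ := h.R₁_pos
  have hG := h.G_nonneg
  have hD2 := rpow_three_halves_sq (x := d) (by linarith)
  have hdD := self_le_rpow_three_halves hd1
  set D := (d : ℝ) ^ (3 / 2 : ℝ) with hD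
  have hD1 : 1 ≤ D := hd1.trans hdD
  set M := max B 1 with hM
  have hM1 : 1 ≤ M := le_max_right _ _
  have hBM : B ≤ M := le_max_left _ _
  set Q := (d : ℝ) ^ 2 * √(S * M) with hQ
  set Z := max Q (κ * D * M) with hZ
  have hQZ : Q ≤ Z := le_max_left _ _
  have hZ' : κ * D * M ≤ Z := le_max_right _ _
  have hDZ : D ≤ Z := by
    refine le_trans ?_ hZ'
    calc D = 1 * D * 1 := by ring
      _ ≤ κ * D * M := by gcongr; linarith
  have hZ1 : 1 ≤ Z := hD1.trans hDZ
  have hC : regretConst L G r R₁ * Z = 30 * √(2 * r + r ^ 2) * Z + 2 * (2 * r + r ^ 2) * L * Z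
      + 2 * L * R₁ ^ 2 * Z + G ^ 2 / L * Z + L * R₁ * r * Z + G * (R₁ + r) * Z := by
    unfold regretConst; rw [abs_of_nonneg hG]; ring
  rw [hC]
  have p1 : 0 ≤ 30 * √(2 * r + r ^ 2) * Z := by positivity
  have p2 : 0 ≤ 2 * (2 * r + r ^ 2) * L * Z := by positivity
  have p3 : 0 ≤ 2 * L * R₁ ^ 2 * Z := by positivity
  have p4 : 0 ≤ G ^ 2 / L * Z := by positivity
  have p5 : 0 ≤ L * R₁ * r * Z := by positivity
  -- The discretization term ηd⁴/T has one factor d too many unless d ≤ T. For T < d the linear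
  -- bound suffices, as d ≤ d^{3/2}.
  rcases lt_or_ge (T : ℝ) d with hTd | hdT
  · have h1 := h.regret_le_linear (μ := μ) (stepSize d r B S (1 / (κ * L * D))) hi
    have h2 : T * (G * r) ≤ Z * (G * r) := by gcongr; linarith
    have h3 : 0 ≤ G * R₁ * Z := by positivity
    linarith
  have hcap0 : 0 < 1 / (κ * L * D) := by positivity
  have hη0 := stepSize_pos (S := S) h.one_le_dim hr hB0 hS0 hcap0
  have hηc := stepSize_le_cap (d := d) (r := r) (B := B) (S := S) (cap := 1 / (κ * L * D))
  obtain ⟨hb1, hb2⟩ := stepSize_balance (S := S) h.one_le_dim hr hB0 hS0 hcap0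
  set η := stepSize d r B S (1 / (κ * L * D)) with hη
  have hηLD : η * (L * D) ≤ 1 / 16 := by
    have h1 : η * (κ * L * D) ≤ 1 := (le_div_iff₀ (by positivity)).1 hηc
    have h2 : 16 * (η * (L * D)) ≤ κ * (η * (L * D)) := by gcongr
    linarith
  have hηL : 96 * η ^ 2 * (d : ℝ) ^ 3 * L ^ 2 ≤ 1 := by
    have h1 : (η * (L * D)) ^ 2 ≤ (1 / 16) ^ 2 := pow_le_pow_left₀ (by positivity) hηLD 2
    calc 96 * η ^ 2 * (d : ℝ) ^ 3 * L ^ 2 = 96 * (η * (L * D)) ^ 2 := by rw [← hD2]; ring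
      _ ≤ 96 * (1 / 16) ^ 2 := by gcongr
      _ ≤ 1 := by norm_num
  have hηd : η * (d : ℝ) ^ 3 ≤ D / (16 * L) := by
    rw [← hD2, le_div_iff₀ (by positivity)]
    calc η * D ^ 2 * (16 * L) = 16 * D * (η * (L * D)) := by ring
      _ ≤ 16 * D * (1 / 16) := by gcongr
      _ = D := by ring
  refine (h.regret_le (μ := μ) hη0 hηL hB ha0 haS ha hi).trans ?_
  have hNM : 2 * r * B + r ^ 2 ≤ (2 * r + r ^ 2) * M := by
    have h1 : 2 * r * B ≤ 2 * r * M := by gcongr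
    have h2 : r ^ 2 ≤ r ^ 2 * M := le_mul_of_one_le_right (by positivity) hM1
    linarith
  have hroot : √(S * (2 * r * B + r ^ 2)) ≤ √(2 * r + r ^ 2) * √(S * M) := by
    rw [← Real.sqrt_mul (by positivity)]
    refine Real.sqrt_le_sqrt ((mul_le_mul_of_nonneg_left hNM hS0).trans_eq (by ring))
  have hrootQ : d ^ 2 * √(S * (2 * r * B + r ^ 2)) ≤ √(2 * r + r ^ 2) * Z := by
    calc _ ≤ d ^ 2 * (√(2 * r + r ^ 2) * √(S * M)) := by gcongr
      _ = √(2 * r + r ^ 2) * Q := by rw [hQ]; ring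
      _ ≤ _ := by gcongr
  have t1 : (3 / 2 * r ^ 2 + r * B) / η
      ≤ 9 / 2 * (√(2 * r + r ^ 2) * Z) + 3 / 2 * ((2 * r + r ^ 2) * L * Z) := by
    have e1 : (3 / 2 * r ^ 2 + r * B) / η ≤ 3 / 2 * ((2 * r * B + r ^ 2) / η) := by
      rw [← mul_div_assoc]
      gcongr
      linarith [mul_nonneg hr.le hB0]
    have e2 : (2 * r * B + r ^ 2) / (1 / (κ * L * D)) ≤ (2 * r + r ^ 2) * L * Z := by
      rw [div_div_eq_mul_div, div_one]
      calc _ ≤ ((2 * r + r ^ 2) * M) * (κ * L * D) := by gcongr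
        _ = (2 * r + r ^ 2) * L * (κ * D * M) := by ring
        _ ≤ _ := by gcongr
    linarith
  have t2 : 24 * η * (d : ℝ) ^ 3 * S ≤ 24 * (√(2 * r + r ^ 2) * Z) := by
    calc 24 * η * (d : ℝ) ^ 3 * S = 24 * (d * (η * d ^ 2 * S)) := by ring
      _ ≤ 24 * (d ^ 2 * √(S * (2 * r * B + r ^ 2))) := by
        gcongr
        -- The variation term is smaller than the 1/η term by a factor d, which is given away here.
        exact le_self_pow₀ hd1 two_ne_zero
      _ ≤ _ := by gcongr
  have t3 : 24 * η * (d : ℝ) ^ 4 * L ^ 2 * R₁ ^ 2 / T ≤ 2 * L * R₁ ^ 2 * Z := by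
    rw [div_le_iff₀ hT0]
    calc 24 * η * (d : ℝ) ^ 4 * L ^ 2 * R₁ ^ 2
        = 24 * (η * (d : ℝ) ^ 3) * d * L ^ 2 * R₁ ^ 2 := by ring
      _ ≤ 24 * (D / (16 * L)) * T * L ^ 2 * R₁ ^ 2 := by gcongr
      _ = 3 / 2 * (L * R₁ ^ 2 * D * T) := by field_simp; ring
      _ ≤ 2 * (L * R₁ ^ 2 * Z * T) := by gcongr; norm_num
      _ = _ := by ring
  have t4 : 2 * η * (d : ℝ) ^ 3 * G ^ 2 ≤ G ^ 2 / L * Z := by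
    calc 2 * η * (d : ℝ) ^ 3 * G ^ 2 = 2 * (η * (d : ℝ) ^ 3) * G ^ 2 := by ring
      _ ≤ 2 * (D / (16 * L)) * G ^ 2 := by gcongr
      _ = 1 / 8 * (G ^ 2 / L * D) := by field_simp; ring
      _ ≤ 1 * (G ^ 2 / L * Z) := by gcongr; norm_num
      _ = _ := by ring
  have t5 : √d * (L * R₁ * r / 2) ≤ L * R₁ * r * Z := by
    have hsd : √(d : ℝ) ≤ Z := by
      have : √(d : ℝ) ≤ d :=
        Real.sqrt_le_iff.2 ⟨by linarith, le_self_pow₀ hd1 two_ne_zero⟩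
      linarith
    have h1 : 0 < L * R₁ * r := by positivity
    have h2 : 0 ≤ √(d : ℝ) * (L * R₁ * r) := by positivity
    linarith [mul_le_mul_of_nonneg_right hsd h1.le]
  have t6 : G * (R₁ + r) ≤ G * (R₁ + r) * Z := le_mul_of_one_le_right (by positivity) hZ1
  linarith

end BanditOCO

/-! ### The two step sizes -/

theorem mainTheorem5 (L G r R₁ R₂ : ℝ) (hL : 0 < L) (hr : 0 < r) (hR₁ : 0 < R₁) :
    ∃ C : ℝ, 0 < C ∧
      ∀ (d : ℕ) (_ : 1 ≤ d) (T : ℕ) (_ : 2 ≤ T) (B S : ℝ≥0)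
        (Ω : Set (BanditOCO.E d)) (_ : IsClosed Ω) (_ : Convex ℝ Ω)
        (_ : Metric.closedBall 0 R₁ ⊆ Ω) (_ : Ω ⊆ Metric.closedBall 0 R₂)
        (f : ℕ → BanditOCO.E d → ℝ) (_ : DifferentiableOn ℝ (f 0) Ω)
        (_ : ∀ t ∈ Finset.Icc 1 T, ConvexOn ℝ Ω (f t))
        (_ : ∀ t ∈ Finset.Icc 1 T, ∀ w ∈ Ω, ∀ w' ∈ Ω, |f t w - f t w'| ≤ G * ‖w - w'‖)
        (_ : ∀ t ∈ Finset.Icc 1 T, BanditOCO.SmoothOn L Ω (f t))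
        (_ : ∀ t ∈ Finset.Icc 1 T, ∀ w' ∈ BanditOCO.minimizers Ω (f t), ∀ w ∈ Ω, ‖w - w'‖ ≤ r)
        (_ : BanditOCO.pathVariation Ω f T ≤ (B : ℝ≥0∞))
        (_ : BanditOCO.gradientVariation Ω f T ≤ (S : ℝ≥0∞))
        (wStar : ℕ → BanditOCO.E d)
        (_ : ∀ t ∈ Finset.Icc 1 T, wStar t ∈ BanditOCO.minimizers Ω (f t))
        (P : Type*) (_ : MeasurableSpace P) (μ : Measure P) (_ : IsProbabilityMeasure μ)
        (i : ℕ → P → Fin d) (_ : BanditOCO.IsUniformIID μ i),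
        -- step size without the factor `√(ln T)`: the bound without that factor
        ((∫ ω, BanditOCO.metaLoss Ω R₁
              (BanditOCO.stepSize d r B S (1 / (16 * L * (d : ℝ) ^ (3 / 2 : ℝ))))
              T f (fun t => i t ω) ∂μ)
            - ∑ t ∈ Finset.Icc 1 T, f t (wStar t)
          ≤ C * max ((d : ℝ) ^ 2 * Real.sqrt (S * max (B : ℝ) 1))
              ((d : ℝ) ^ (3 / 2 : ℝ) * max (B : ℝ) 1)) ∧
        -- step size with the factor `√(ln T)`: the bound with that factor
        ((∫ ω, BanditOCO.metaLoss Ω R₁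
              (BanditOCO.stepSize d r B S
                (1 / (4 * L * (d : ℝ) ^ (3 / 2 : ℝ) * Real.sqrt (Real.log T))))
              T f (fun t => i t ω) ∂μ)
            - ∑ t ∈ Finset.Icc 1 T, f t (wStar t)
          ≤ C * max ((d : ℝ) ^ 2 * Real.sqrt (S * max (B : ℝ) 1))
              ((d : ℝ) ^ (3 / 2 : ℝ) * Real.sqrt (Real.log T) * max (B : ℝ) 1)) := by
  have hC₀ := BanditOCO.regretConst_nonneg G hL hr hR₁
  set C₀ := BanditOCO.regretConst L G r R₁ with hC₀def
  -- The factor 16 removes κ from the maximum, the exponential covers T ≤ e¹⁶ under the second step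
  -- size, and 1 gives positivity. The absolute value is used since the sign of G is known only once
  -- a domain is given.
  refine ⟨16 * C₀ + 2 * Real.exp 16 * (|G| * r) + 1, by positivity, ?_⟩
  intro d hd T hT B S Ω hcl hcv hball _ f _ hconv hlip hsm hdist hpath hgrad wStar hw P _ μ _ i hi
  have h : BanditOCO.Setting L G r R₁ T Ω f wStar :=
    ⟨hd, hT, hL, hR₁, hcl, hcv, hball, fun t ht => ⟨hconv t ht, hlip t ht, hsm t ht⟩,
      fun t ht => hdist t ht _ (hw t ht), fun t ht => (hw t ht).1⟩
  have hB := BanditOCO.Setting.sum_norm_sub_le_of_pathVariation_le hpath hw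
  obtain ⟨a, ha0, haS, ha⟩ := BanditOCO.Setting.exists_gradient_budget hgrad
  have hreg : ∀ κ : ℝ, 16 ≤ κ → _ := fun κ hκ =>
    h.tuned_regret_le (μ := μ) hr B.2 S.2 hB ha0 haS ha hi hκ
  have hd1 : (1 : ℝ) ≤ d := by exact_mod_cast hd
  have hD1 : 1 ≤ (d : ℝ) ^ (3 / 2 : ℝ) := hd1.trans (BanditOCO.self_le_rpow_three_halves hd1)
  have hT2 : (2 : ℝ) ≤ T := by exact_mod_cast hT
  set D := (d : ℝ) ^ (3 / 2 : ℝ) with hD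
  set M := max (B : ℝ) 1 with hM
  have hM1 : 1 ≤ M := le_max_right _ _
  set Q := (d : ℝ) ^ 2 * √(S * M) with hQ
  have hQ0 : 0 ≤ Q := by positivity
  have hE : 0 ≤ 2 * Real.exp 16 * (|G| * r) := by positivity
  have hscale : ∀ κ Y : ℝ, 0 ≤ Y → κ = 16 * Y ∨ κ = 4 * Y →
      C₀ * max Q (κ * D * M)
        ≤ (16 * C₀ + 2 * Real.exp 16 * (|G| * r) + 1) * max Q (D * Y * M) := by
    intro κ Y hY hκ
    have h0 : 0 ≤ max Q (D * Y * M) := hQ0.trans (le_max_left _ _)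
    have h1 : max Q (κ * D * M) ≤ 16 * max Q (D * Y * M) := by
      refine max_le (by linarith [le_max_left Q (D * Y * M)]) ?_
      have h2 := le_max_right Q (D * Y * M)
      have h3 : 0 ≤ D * Y * M := by positivity
      rcases hκ with rfl | rfl <;> nlinarith
    nlinarith [mul_le_mul_of_nonneg_left h1 hC₀]
  constructor
  · have h1 := (hreg 16 le_rfl).trans (hscale 16 1 zero_le_one (by norm_num))
    rwa [mul_one] at h1
  · set Y := √(Real.log T) with hY
    have hκ : 1 / (4 * L * D * Y) = 1 / (4 * Y * L * D) := by ring
    rw [hκ]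
    -- With κ = 4√(ln T) the smoothness threshold may fail for small T. Then √(ln T) < 4 bounds T by
    -- e¹⁶, and ln T ≥ 1/4 keeps the maximum above 1/2, so a constant regret is acceptable.
    rcases le_or_gt 16 (4 * Y) with h16 | h16
    · exact (hreg (4 * Y) h16).trans (hscale (4 * Y) Y (Real.sqrt_nonneg _) (Or.inr rfl))
    · have hlin := h.regret_le_linear (μ := μ)
        (BanditOCO.stepSize d r B S (1 / (4 * Y * L * D))) hi
      refine hlin.trans ?_
      have hlog : 1 / 4 ≤ Real.log T := by
        have := Real.log_le_log (by norm_num) hT2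
        linarith [Real.log_two_gt_d9]
      have hTe : (T : ℝ) ≤ Real.exp 16 := by
        rw [← Real.log_le_iff_le_exp (by linarith), ← Real.sq_sqrt (by linarith : 0 ≤ Real.log T)]
        nlinarith [Real.sqrt_nonneg (Real.log T)]
      have hY2 : 1 / 2 ≤ Y := Real.le_sqrt_of_sq_le (by linarith)
      have hZ : 1 / 2 ≤ max Q (D * Y * M) := by
        refine le_trans ?_ (le_max_right _ _)
        have : 1 * (1 / 2) * 1 ≤ D * Y * M := by gcongr
        linarith
      have h1 : T * (G * r) ≤ Real.exp 16 * (|G| * r) := by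
        have := le_abs_self G
        calc (T : ℝ) * (G * r) ≤ T * (|G| * r) := by gcongr
          _ ≤ _ := by gcongr
      have h2 : 2 * Real.exp 16 * (|G| * r) * (1 / 2)
          ≤ 2 * Real.exp 16 * (|G| * r) * max Q (D * Y * M) := by gcongr
      have h3 : 0 ≤ (16 * C₀ + 1) * max Q (D * Y * M) := by positivity
      linarith
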